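/- Let $m\ge 3$, and let $I=\{1,\dots,m\}$ be the Dynkin diagram of type $D_m$, with spin nodes $m-1,m$, simple roots $\alpha_i$ and Weyl group $W$. For a connected subdiagram $J\subseteq I$ let $w_{0,J}$ be the longest element of the parabolic subgroup $W_J$, and let $\theta_J:J\to J$ be given by $\alpha_{\theta_J(j)}=-w_{0,J}\alpha_j$. The cactus group $C_{D_m}$ has one generator $c_J$ for each non-empty connected subdiagram $J$, and relations $c_J^2=1$; $c_Jc_K=c_Kc_J$ if $J\cup K$ is disconnected; and $c_Jc_K=c_Kc_{\theta_K(J)}$ if $J\subseteq K$. For $n\ge 0$ let $B(n\varpi_1)$ be the $D_m$-crystal of weakly increasing rows of length $n$ with entries in $1<\dots<m-1<m,\overline m<\overline{m-1}<\dots<\overline 1$ ($m$ and $\overline m$ incomparable), with the crystal operators induced from the embedding $b_1\cdots b_n\mapsto b_1\otimes\cdots\otimes b_n$ into $B(\varpi_1)^{\otimes n}$, where $f_i(b_1\otimes b_2)=b_1\otimes f_i(b_2)$ if $\varepsilon_i(b_1)<\phi_i(b_2)$ and $f_i(b_1\otimes b_2)=f_i(b_1)\otimes b_2$ otherwise. There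 is a unique action of $C_{D_m}$ on the set $B(n\varpi_1)$ in which each $c_J$ acts by the Schützenberger involution $\xi_J$ of the crystal restricted to $J$, that is, the map preserving each connected component of the restricted crystal with $\mathrm{wt}(\xi_J b)=w_{0,J}\mathrm{wt}(b)$, $e_j\xi_J(b)=\xi_J(f_{\theta_J(j)}b)$ and $f_j\xi_J(b)=\xi_J(e_{\theta_J(j)}b)$ for all $j\in J$ (where $\xi_J(0)=0$). This action is generated by the cactus elements of connected subdiagrams of size $1$ and $2$: for every $n$, the image of $C_{D_m}$ in the symmetric group $S_{B(n\varpi_1)}$ is the subgroup generated by the images of the $c_J$ with $J$ connected and $|J|\in\{1,2\}$. The same holds for all $n$ simultaneously: the image of $C_{D_m}$ in $\prod_{n\ge 0}S_{B(n\varpi_1)}$ is generated by the images of these $c_J$. -/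

import Mathlib

/-! ### The root system and Weyl group of type `D_m`

The nodes `1, …, m` of the Dynkin diagram are the elements `0, …, m - 1` of `Fin m`, so that the
spin nodes are `m - 2` and `m - 1`. Weights are written in the coordinates `ε_1, …, ε_m`; all the
weights that occur below lie in the sublattice `ℤ^m` of the weight lattice. -/

/-- The simple roots: `α_i = ε_i - ε_{i+1}` for `i < m`, and `α_m = ε_{m-1} + ε_m`
(labels starting from `1`). -/
def simpleRoot {m : ℕ} (i : Fin m) : Fin m → ℤ := fun k =>
  if k = i then 1
  else if i.1 + 1 < m then (if k.1 = i.1 + 1 then -1 else 0)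
  else (if k.1 + 2 = m then 1 else 0)

/-- The simple reflection `s_i v = v - ⟨v, α_i⟩ α_i` (every root has square length `2`). -/
def simpleReflection {m : ℕ} (i : Fin m) : Module.End ℤ (Fin m → ℤ) where
  toFun v := v - (simpleRoot i ⬝ᵥ v) • simpleRoot i
  map_add' v w := by rw [dotProduct_add, add_smul]; abel
  map_smul' c v := by
    rw [dotProduct_smul, smul_assoc, smul_sub, RingHom.id_apply]

/-- The element `s_{i_1} ⋯ s_{i_l}` of the Weyl group, acting on `ℤ^m`. -/
def weylWord {m : ℕ} (l : List (Fin m)) : Module.End ℤ (Fin m → ℤ) :=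
  (l.map simpleReflection).prod

/-- The parabolic subgroup `W_J`, the set of all products of simple reflections `s_j`, `j ∈ J`. -/
def parabolic {m : ℕ} (J : Finset (Fin m)) : Set (Module.End ℤ (Fin m → ℤ)) :=
  {w | ∃ l : List (Fin m), (∀ i ∈ l, i ∈ J) ∧ weylWord l = w}

/-- The Coxeter length in `W_J`: the least length of a word in the `s_j`, `j ∈ J`. -/
noncomputable def parabolicLength {m : ℕ} (J : Finset (Fin m))
    (w : Module.End ℤ (Fin m → ℤ)) : ℕ :=
  sInf {k | ∃ l : List (Fin m), (∀ i ∈ l, i ∈ J) ∧ weylWord l = w ∧ l.length = k}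

/-- `w` is an element of greatest length of `W_J`. -/
def IsLongest {m : ℕ} (J : Finset (Fin m)) (w : Module.End ℤ (Fin m → ℤ)) : Prop :=
  w ∈ parabolic J ∧ ∀ v ∈ parabolic J, parabolicLength J v ≤ parabolicLength J w

/-- The longest element `w_{0,J}` of `W_J`. -/
noncomputable def longestElement {m : ℕ} (J : Finset (Fin m)) : Module.End ℤ (Fin m → ℤ) :=
  Classical.epsilon (IsLongest J)

theorem simpleReflection_single {m : ℕ} (hm : 2 ≤ m) (i k : Fin m) (c : ℤ) :
    ∃ k' : Fin m, simpleReflection i (Pi.single k c) = Pi.single k' c ∨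
      simpleReflection i (Pi.single k c) = Pi.single k' (-c) := by
  have hs : simpleReflection i (Pi.single k c) =
      Pi.single k c - (simpleRoot i k * c) • simpleRoot i := by
    simp [simpleReflection]
  rw [hs]
  by_cases hi : i.1 + 1 < m
  · by_cases h1 : k = i
    · refine ⟨⟨i.1 + 1, hi⟩, Or.inl ?_⟩
      ext l
      simp only [simpleRoot, Pi.single_apply, Pi.sub_apply, Pi.smul_apply, smul_eq_mul, Fin.ext_iff]
      split_ifs <;> simp [Fin.ext_iff] at * <;> omega
    · by_cases h2 : k.1 = i.1 + 1
      · refine ⟨i, Or.inl ?_⟩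
        ext l
        simp only [simpleRoot, Pi.single_apply, Pi.sub_apply, Pi.smul_apply, smul_eq_mul,
          Fin.ext_iff]
        split_ifs <;> simp [Fin.ext_iff] at * <;> omega
      · refine ⟨k, Or.inl ?_⟩
        simp [simpleRoot, h1, h2, hi]
  · by_cases h1 : k = i
    · refine ⟨⟨i.1 - 1, by omega⟩, Or.inr ?_⟩
      ext l
      simp only [simpleRoot, Pi.single_apply, Pi.sub_apply, Pi.smul_apply, smul_eq_mul, Fin.ext_iff]
      split_ifs <;> simp [Fin.ext_iff] at * <;> omega
    · by_cases h2 : k.1 + 2 = m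
      · refine ⟨i, Or.inr ?_⟩
        ext l
        simp only [simpleRoot, Pi.single_apply, Pi.sub_apply, Pi.smul_apply, smul_eq_mul,
          Fin.ext_iff]
        split_ifs <;> simp [Fin.ext_iff] at * <;> omega
      · refine ⟨k, Or.inl ?_⟩
        simp [simpleRoot, h1, h2, hi]

theorem weylWord_single {m : ℕ} (hm : 2 ≤ m) (l : List (Fin m)) (k : Fin m) :
    ∃ k' : Fin m, weylWord l (Pi.single k 1) = Pi.single k' 1 ∨
      weylWord l (Pi.single k 1) = Pi.single k' (-1) := by
  induction l with
  | nil => exact ⟨k, Or.inl rfl⟩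
  | cons i l ih =>
    have hc : weylWord (i :: l) (Pi.single k 1) =
        simpleReflection i (weylWord l (Pi.single k 1)) := by
      simp [weylWord]
    obtain ⟨k', h | h⟩ := ih
    · obtain ⟨k'', h''⟩ := simpleReflection_single hm i k' 1
      rw [hc, h]; exact ⟨k'', h''⟩
    · obtain ⟨k'', h''⟩ := simpleReflection_single hm i k' (-1)
      rw [neg_neg] at h''
      rw [hc, h]; exact ⟨k'', h''.symm⟩

theorem finite_parabolic {m : ℕ} (hm : 2 ≤ m) (J : Finset (Fin m)) : (parabolic J).Finite := by
  let S : Set (Fin m → ℤ) :=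
    Set.range (fun k : Fin m => Pi.single k (1 : ℤ)) ∪ Set.range (fun k => Pi.single k (-1 : ℤ))
  have hS : S.Finite := (Set.finite_range _).union (Set.finite_range _)
  have hT : (Set.univ.pi (fun _ : Fin m => S)).Finite := Set.Finite.pi' (fun _ => hS) |>.subset
    (by intro g hg k; exact hg k (Set.mem_univ k))
  refine Set.Finite.of_finite_image (f := fun w (k : Fin m) => w (Pi.single k 1))
    (hT.subset ?_) ?_
  · rintro _ ⟨_, ⟨l, -, rfl⟩, rfl⟩ k -
    obtain ⟨k', h | h⟩ := weylWord_single hm l k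
    · exact Or.inl ⟨k', h.symm⟩
    · exact Or.inr ⟨k', h.symm⟩
  · intro v _ w _ h
    exact LinearMap.pi_ext' fun k => LinearMap.ext_ring (congrFun h k)

theorem isLongest_longestElement {m : ℕ} (hm : 2 ≤ m) (J : Finset (Fin m)) :
    IsLongest J (longestElement J) := by
  obtain ⟨w, hw, h⟩ := (finite_parabolic hm J).exists_maximalFor (parabolicLength J) _
    ⟨1, [], by simp, rfl⟩
  exact Classical.epsilon_spec (p := IsLongest J)
    ⟨w, hw, fun v hv => (le_total _ _).elim id (fun h' => h hv h')⟩

open Classical in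
/-- The map `θ_J : J → J` given by `α_{θ_J(j)} = - w_{0,J} α_j`
(extended by the identity outside its domain). -/
noncomputable def theta {m : ℕ} (J : Finset (Fin m)) (j : Fin m) : Fin m :=
  if h : j ∈ J ∧ ∃ k ∈ J, simpleRoot k = -(longestElement J (simpleRoot j)) then h.2.choose else j

/-- The Dynkin diagram of type `D_m`: distinct nodes are joined when their simple roots are not
orthogonal. -/
def dynkin (m : ℕ) : SimpleGraph (Fin m) where
  Adj i j := i ≠ j ∧ simpleRoot i ⬝ᵥ simpleRoot j ≠ 0
  symm := ⟨fun i j h => ⟨h.1.symm, by rw [dotProduct_comm]; exact h.2⟩⟩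
  loopless := ⟨fun _ h => h.1 rfl⟩

/-- The (non-empty) connected subdiagrams of the Dynkin diagram. -/
def ConnectedSubdiagram (m : ℕ) : Type :=
  {J : Finset (Fin m) // ((dynkin m).induce (J : Set (Fin m))).Connected}

/-! ### The cactus group -/

/-- The relators of the cactus group, from `c_J^2 = 1`, from `c_J c_K = c_K c_J` if `J ∪ K` is
disconnected, and from `c_J c_K = c_K c_{θ_K(J)}` if `J ⊆ K`. -/
inductive CactusRelator (m : ℕ) : FreeGroup (ConnectedSubdiagram m) → Prop
  | sq (J : ConnectedSubdiagram m) :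
      CactusRelator m (FreeGroup.of J * FreeGroup.of J)
  | comm (J K : ConnectedSubdiagram m)
      (h : ¬ ((dynkin m).induce ((J.1 ∪ K.1 : Finset (Fin m)) : Set (Fin m))).Connected) :
      CactusRelator m
        ((FreeGroup.of J * FreeGroup.of K) * (FreeGroup.of K * FreeGroup.of J)⁻¹)
  | nest (J K J' : ConnectedSubdiagram m) (h : J.1 ⊆ K.1) (h' : J'.1 = J.1.image (theta K.1)) :
      CactusRelator m
        ((FreeGroup.of J * FreeGroup.of K) * (FreeGroup.of K * FreeGroup.of J')⁻¹)

/-- The cactus group `C_{D_m}`. -/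
abbrev CactusGroup (m : ℕ) : Type := PresentedGroup {r | CactusRelator m r}

/-- The generator `c_J` of the cactus group. -/
def cactusGen {m : ℕ} (J : ConnectedSubdiagram m) : CactusGroup m := PresentedGroup.of J

/-! ### Crystals -/

/-- Weights and raising and lowering operators on a set `B`; the value `none` is the symbol `0`.
Used below only for the concrete crystals that are built here. -/
structure CrystalData (m : ℕ) (B : Type) where
  wt : B → (Fin m → ℤ)
  e : Fin m → B → Option B
  f : Fin m → B → Option B

/-- `max {k | g^k b ≠ 0}`. -/
noncomputable def stringLength {B : Type} (g : B → Option B) (b : B) : ℕ :=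
  sSup {k | (fun o : Option B => o.bind g)^[k] (some b) ≠ none}

namespace CrystalData

variable {m : ℕ} {B B' : Type}

/-- `ε_i`. -/
noncomputable def eps (C : CrystalData m B) (i : Fin m) (b : B) : ℕ := stringLength (C.e i) b

/-- `φ_i`. -/
noncomputable def phi (C : CrystalData m B) (i : Fin m) (b : B) : ℕ := stringLength (C.f i) b

/-- The tensor product: `f_i (b₁ ⊗ b₂)` is `b₁ ⊗ f_i b₂` if `ε_i b₁ < φ_i b₂` and `f_i b₁ ⊗ b₂`
otherwise, and `e_i` is the partial inverse of `f_i`. -/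
noncomputable def tensor (C : CrystalData m B) (C' : CrystalData m B') :
    CrystalData m (B × B') where
  wt b := C.wt b.1 + C'.wt b.2
  f i b := if C.eps i b.1 < C'.phi i b.2 then (C'.f i b.2).map (fun x => (b.1, x))
    else (C.f i b.1).map (fun x => (x, b.2))
  e i b := if C.eps i b.1 ≤ C'.phi i b.2 then (C'.e i b.2).map (fun x => (b.1, x))
    else (C.e i b.1).map (fun x => (x, b.2))

/-- Transport of the structure along a bijection. -/
def transport (C : CrystalData m B) (g : B ≃ B') : CrystalData m B' where
  wt b := C.wt (g.symm b)
  e i b := (C.e i (g.symm b)).map g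
  f i b := (C.f i (g.symm b)).map g

/-- The tensor power `B^{⊗ n}`, where `b : Fin n → B` stands for `b_1 ⊗ ⋯ ⊗ b_n`. -/
noncomputable def tensorPower (C : CrystalData m B) : (n : ℕ) → CrystalData m (Fin n → B)
  | 0 => { wt := fun _ => 0, e := fun _ _ => none, f := fun _ _ => none }
  | n + 1 => (C.tensor (C.tensorPower n)).transport (Fin.consEquiv (fun _ : Fin (n + 1) => B))

open Classical in
/-- The restriction of the structure to a subset (applied to a subset that is stable under all
raising and lowering operators). -/
noncomputable def restrict (C : CrystalData m B) (p : B → Prop) : CrystalData m {b // p b} where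
  wt b := C.wt b.1
  e i b := (C.e i b.1).bind (fun x => if h : p x then some ⟨x, h⟩ else none)
  f i b := (C.f i b.1).bind (fun x => if h : p x then some ⟨x, h⟩ else none)

/-- `b` and `b'` lie in the same connected component of `B_J`, the crystal that keeps all vertices
of `B` and only the edges labelled by `J`. -/
def SameComponent (C : CrystalData m B) (J : Finset (Fin m)) : B → B → Prop :=
  Relation.EqvGen (fun b b' => ∃ j ∈ J, C.f j b = some b')

/-- `ξ` is the Schützenberger involution of `B_J`: it acts on each connected component of `B_J`,
by `wt (ξ b) = w_{0,J} (wt b)`, `e_j (ξ b) = ξ (f_{θ_J(j)} b)` and `f_j (ξ b) = ξ (e_{θ_J(j)} b)`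
for `j ∈ J`, with `ξ 0 = 0`. -/
structure IsSchutzenberger (C : CrystalData m B) (J : Finset (Fin m)) (ξ : B → B) : Prop where
  component : ∀ b, C.SameComponent J b (ξ b)
  weight : ∀ b, C.wt (ξ b) = longestElement J (C.wt b)
  e_apply : ∀ j ∈ J, ∀ b, C.e j (ξ b) = (C.f (theta J j) b).map ξ
  f_apply : ∀ j ∈ J, ∀ b, C.f j (ξ b) = (C.e (theta J j) b).map ξ

end CrystalData

/-! ### The crystal `B(n ϖ_1)` -/

/-- The entries of tableaux: `pos i` is `i`, and `bar i` is `i` with a bar. -/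
inductive Letter (m : ℕ) : Type
  | pos (i : Fin m) : Letter m
  | bar (i : Fin m) : Letter m

namespace Letter

variable {m : ℕ}

/-- `1 < 2 < ⋯ < m - 1 < m, m̄ < ⋯ < 2̄ < 1̄`, where `m` and `m̄` are incomparable. -/
protected def le : Letter m → Letter m → Prop
  | pos i, pos j => i ≤ j
  | pos i, bar j => ¬ (i.1 + 1 = m ∧ j.1 + 1 = m)
  | bar _, pos _ => False
  | bar i, bar j => j ≤ i

instance : PartialOrder (Letter m) where
  le := Letter.le
  le_refl a := by cases a <;> exact le_refl _
  le_trans a b c := by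
    cases a <;> cases b <;> cases c <;> simp only [Letter.le, Fin.le_def] <;>
      intro h h' <;> first | contradiction | omega
  le_antisymm a b := by
    cases a <;> cases b <;> simp only [Letter.le, Fin.le_def] <;> intro h h' <;>
      first | contradiction | (congr 1; exact Fin.ext (by omega))

/-- `i` has weight `ε_i`, and `ī` has weight `-ε_i`. -/
def wt : Letter m → (Fin m → ℤ)
  | pos k => Pi.single k 1
  | bar k => -Pi.single k 1

/-- The arrows of `B(ϖ_1)`, in labels starting from `1`: for `i < m` the arrows labelled `i` are
`i → i + 1` and `(i + 1)̄ → ī`; those labelled `m` are `m - 1 → m̄` and `m → (m - 1)̄`. -/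
def lower (i : Fin m) : Letter m → Option (Letter m)
  | pos k =>
    if h : i.1 + 1 < m then (if k = i then some (pos ⟨i.1 + 1, h⟩) else none)
    else if k.1 + 2 = m then some (bar i)
    else if k = i then some (bar ⟨i.1 - 1, by omega⟩)
    else none
  | bar k => if i.1 + 1 < m ∧ k.1 = i.1 + 1 then some (bar i) else none

/-- The arrows of `B(ϖ_1)`, reversed. -/
def raise (i : Fin m) : Letter m → Option (Letter m)
  | pos k => if i.1 + 1 < m ∧ k.1 = i.1 + 1 then some (pos i) else none
  | bar k =>
    if h : i.1 + 1 < m then (if k = i then some (bar ⟨i.1 + 1, h⟩) else none)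
    else if k = i then some (pos ⟨i.1 - 1, by omega⟩)
    else if k.1 + 2 = m then some (pos i)
    else none

theorem raise_eq_some_iff (hm : 2 ≤ m) (i : Fin m) (a b : Letter m) :
    raise i a = some b ↔ lower i b = some a := by
  cases a <;> cases b <;> simp only [raise, lower] <;> split_ifs <;>
    simp [Fin.ext_iff] at * <;> omega

end Letter

/-- The crystal `B(ϖ_1)`. -/
def vectorCrystal (m : ℕ) : CrystalData m (Letter m) where
  wt := Letter.wt
  e := Letter.raise
  f := Letter.lower

/-- The tableaux of shape `1 × n` with entries weakly increasing from left to right. -/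
abbrev RowTableau (m n : ℕ) : Type := {b : Fin n → Letter m // Monotone b}

/-- The crystal `B(n ϖ_1)`: the row tableaux, inside `B(ϖ_1)^{⊗ n}`. -/
noncomputable def rowCrystal (m n : ℕ) : CrystalData m (RowTableau m n) :=
  ((vectorCrystal m).tensorPower n).restrict Monotone

/-- The action of the cactus group on `B(n ϖ_1)`: each `c_J` acts by the Schützenberger involution
of `B(n ϖ_1)_J`. -/
def IsCactusAction (m n : ℕ) (ρ : CactusGroup m →* Equiv.Perm (RowTableau m n)) : Prop :=
  ∀ J : ConnectedSubdiagram m, (rowCrystal m n).IsSchutzenberger J.1 (ρ (cactusGen J))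

/-! ### Seminormal crystals and their tensor products -/

/-! Labels start from 1. A row has two kinds of coordinates: its weight z in ℤ^m, with z_k = #k -
#k̄, and its defects d_k = min(#k, #k̄). The incomparability of m and m̄ forces d_m = 0. Weight and
defects determine the row (`row_ext`), and the only further constraint on them is Σ|z_k| + 2 Σ d_k =
n (`exists_row`).

In these coordinates the crystal is simple. Write α_j = ε_c - s with s = ±ε_{c'}; here c, the column
of j, is j for j < m and m - 1 for j = m, so both spin nodes have the same column. Then ε_j and φ_j
depend only on z_c, on the value of s and on d_c (`rowCrystal_string`), and f_j subtracts α_j from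
the weight and changes no defect outside column c (`row_f_iff`).

Consequently the Schützenberger involution ξ_J acts by w_{0,J} on the weight and by a permutation
π_J of the columns on the defects. For a type A interval of nodes, π_J reverses their columns; if J
contains both spin nodes, θ_J moves nothing except possibly the spin nodes, so π_J is trivial. The
remaining J come from intervals by the diagram automorphism that exchanges the spin nodes. The
commutation rules for f_j and e_j follow from the string formulas. Preservation of components
follows because a highest weight row of a J-component is determined by invariants of the component
that w_{0,J} and π_J respect.

Thus c_J acts through the pair (w_{0,J}, π_J), in a group `rowSymmetry` of ℓ¹-isometries paired with
column permutations that does not depend on n. The cactus relations are checked in that group. A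
single node i gives (s_i, 1), so every (w, 1) with w in W is generated. A pair {k, k+1} with k + 1 <
m gives (w, (k k+1)), and removing w leaves (1, (k k+1)). These transpositions generate every π_J,
hence every (w_{0,J}, π_J). Since the argument takes place before any n is chosen, it gives the
statement for each n and for the product over all n. -/

theorem stringLength_eq {B : Type} (g : B → Option B) (φ : B → ℕ)
    (h0 : ∀ b, g b = none ↔ φ b = 0) (h1 : ∀ b b', g b = some b' → φ b = φ b' + 1) (b : B) :
    stringLength g b = φ b := by
  have hnone : ∀ k, (fun o : Option B => o.bind g)^[k] none = none := by
    intro k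
    induction k with
    | zero => rfl
    | succ k ih => rw [Function.iterate_succ_apply]; exact ih
  have key : ∀ k b, (fun o : Option B => o.bind g)^[k] (some b) ≠ none ↔ k ≤ φ b := by
    intro k
    induction k with
    | zero => intro b; simp
    | succ k ih =>
      intro b
      rw [Function.iterate_succ_apply]
      rcases hb : g b with _ | b'
      · simp [hb, hnone, (h0 b).1 hb]
      · simp only [Option.bind_some, hb]
        rw [ih, h1 b b' hb]
        omega
  unfold stringLength
  simp only [key]
  exact csSup_Iic

namespace CrystalData

variable {m : ℕ} {B B' : Type}

/-- The lowering operators are partial inverses of the raising operators, and `ε_i`, `φ_i` are the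
finite lengths of the strings. -/
structure Seminormal (C : CrystalData m B) : Prop where
  inv : ∀ i a b, C.e i a = some b ↔ C.f i b = some a
  e_none : ∀ i b, C.e i b = none ↔ C.eps i b = 0
  f_none : ∀ i b, C.f i b = none ↔ C.phi i b = 0
  eps_f : ∀ i b b', C.f i b = some b' → C.eps i b' = C.eps i b + 1
  phi_f : ∀ i b b', C.f i b = some b' → C.phi i b = C.phi i b' + 1

/-- Functions that vanish exactly where an operator does and change by one along each arrow must be
the string lengths. So each construction of a crystal needs only a proposed formula for ε and φ. -/
theorem seminormal_of (C : CrystalData m B) (ε φ : Fin m → B → ℕ)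
    (inv : ∀ i a b, C.e i a = some b ↔ C.f i b = some a)
    (e_none : ∀ i b, C.e i b = none ↔ ε i b = 0)
    (f_none : ∀ i b, C.f i b = none ↔ φ i b = 0)
    (eps_f : ∀ i b b', C.f i b = some b' → ε i b' = ε i b + 1)
    (phi_f : ∀ i b b', C.f i b = some b' → φ i b = φ i b' + 1) :
    C.Seminormal ∧ (∀ i b, C.eps i b = ε i b) ∧ ∀ i b, C.phi i b = φ i b := by
  have h1 : ∀ i b, C.eps i b = ε i b := fun i b =>
    stringLength_eq _ _ (e_none i) (fun b b' h => eps_f i _ _ ((inv i _ _).1 h)) b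
  have h2 : ∀ i b, C.phi i b = φ i b := fun i b =>
    stringLength_eq _ _ (f_none i) (phi_f i) b
  refine ⟨⟨inv, ?_, ?_, ?_, ?_⟩, h1, h2⟩ <;> simpa only [h1, h2]

/-- The comparison of ε_i(b₁) with φ_i(b₂) selects the same factor before and after an arrow: f_i
turns the strict inequality in the rule for f_i into the weak one in the rule for e_i, and likewise
on the complementary side. -/
theorem tensor_seminormal {C : CrystalData m B} {C' : CrystalData m B'} (h : C.Seminormal)
    (h' : C'.Seminormal) :
    (C.tensor C').Seminormal ∧
    (∀ i b, (C.tensor C').eps i b = C'.eps i b.2 + (C.eps i b.1 - C'.phi i b.2)) ∧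
    ∀ i b, (C.tensor C').phi i b = C.phi i b.1 + (C'.phi i b.2 - C.eps i b.1) := by
  have he : ∀ i a b, C.e i a = some b → C.eps i a = C.eps i b + 1 ∧
      C.phi i b = C.phi i a + 1 := fun i a b hab =>
    ⟨h.eps_f i _ _ ((h.inv i a b).1 hab), h.phi_f i _ _ ((h.inv i a b).1 hab)⟩
  have he' : ∀ i a b, C'.e i a = some b → C'.eps i a = C'.eps i b + 1 ∧
      C'.phi i b = C'.phi i a + 1 := fun i a b hab =>
    ⟨h'.eps_f i _ _ ((h'.inv i a b).1 hab), h'.phi_f i _ _ ((h'.inv i a b).1 hab)⟩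
  apply seminormal_of
  · rintro i ⟨a, a'⟩ ⟨b, b'⟩
    simp only [tensor]
    constructor
    · intro hh
      split_ifs at hh with hc
      · simp only [Option.map_eq_some_iff, Prod.mk.injEq] at hh
        obtain ⟨x, hx, rfl, rfl⟩ := hh
        have := he' _ _ _ hx
        rw [if_pos (by omega), (h'.inv i _ _).1 hx]; rfl
      · simp only [Option.map_eq_some_iff, Prod.mk.injEq] at hh
        obtain ⟨x, hx, rfl, rfl⟩ := hh
        have := he _ _ _ hx
        rw [if_neg (by omega), (h.inv i _ _).1 hx]; rfl
    · intro hh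
      split_ifs at hh with hc
      · simp only [Option.map_eq_some_iff, Prod.mk.injEq] at hh
        obtain ⟨x, hx, rfl, rfl⟩ := hh
        have := h'.phi_f _ _ _ hx
        rw [if_pos (by omega), (h'.inv i _ _).2 hx]; rfl
      · simp only [Option.map_eq_some_iff, Prod.mk.injEq] at hh
        obtain ⟨x, hx, rfl, rfl⟩ := hh
        have := h.eps_f _ _ _ hx
        rw [if_neg (by omega), (h.inv i _ _).2 hx]; rfl
  · rintro i ⟨a, a'⟩
    simp only [tensor]
    split_ifs with hc
    · rw [Option.map_eq_none_iff, h'.e_none]; omega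
    · rw [Option.map_eq_none_iff, h.e_none]; omega
  · rintro i ⟨a, a'⟩
    simp only [tensor]
    split_ifs with hc
    · rw [Option.map_eq_none_iff, h'.f_none]; omega
    · rw [Option.map_eq_none_iff, h.f_none]; omega
  · rintro i ⟨a, a'⟩ ⟨b, b'⟩ hh
    simp only [tensor] at hh
    split_ifs at hh with hc
    · simp only [Option.map_eq_some_iff, Prod.mk.injEq] at hh
      obtain ⟨x, hx, rfl, rfl⟩ := hh
      have := h'.phi_f _ _ _ hx
      have := h'.eps_f _ _ _ hx
      simp only; omega
    · simp only [Option.map_eq_some_iff, Prod.mk.injEq] at hh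
      obtain ⟨x, hx, rfl, rfl⟩ := hh
      have := h.phi_f _ _ _ hx
      have := h.eps_f _ _ _ hx
      simp only; omega
  · rintro i ⟨a, a'⟩ ⟨b, b'⟩ hh
    simp only [tensor] at hh
    split_ifs at hh with hc
    · simp only [Option.map_eq_some_iff, Prod.mk.injEq] at hh
      obtain ⟨x, hx, rfl, rfl⟩ := hh
      have := h'.phi_f _ _ _ hx
      have := h'.eps_f _ _ _ hx
      simp only; omega
    · simp only [Option.map_eq_some_iff, Prod.mk.injEq] at hh
      obtain ⟨x, hx, rfl, rfl⟩ := hh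
      have := h.phi_f _ _ _ hx
      have := h.eps_f _ _ _ hx
      simp only; omega

theorem transport_seminormal {C : CrystalData m B} (h : C.Seminormal) (g : B ≃ B') :
    (C.transport g).Seminormal ∧
    (∀ i b, (C.transport g).eps i b = C.eps i (g.symm b)) ∧
    ∀ i b, (C.transport g).phi i b = C.phi i (g.symm b) := by
  apply seminormal_of
  · intro i a b
    simp only [transport, Option.map_eq_some_iff]
    constructor
    · rintro ⟨x, hx, rfl⟩
      exact ⟨g.symm a, by simpa using (h.inv i _ _).1 hx, by simp⟩
    · rintro ⟨x, hx, rfl⟩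
      exact ⟨g.symm b, by simpa using (h.inv i _ _).2 hx, by simp⟩
  · intro i b; simp only [transport, Option.map_eq_none_iff, h.e_none]
  · intro i b; simp only [transport, Option.map_eq_none_iff, h.f_none]
  · intro i b b' hb
    simp only [transport, Option.map_eq_some_iff] at hb
    obtain ⟨x, hx, rfl⟩ := hb
    simpa using h.eps_f _ _ _ hx
  · intro i b b' hb
    simp only [transport, Option.map_eq_some_iff] at hb
    obtain ⟨x, hx, rfl⟩ := hb
    simpa using h.phi_f _ _ _ hx

theorem restrict_f_eq {C : CrystalData m B} {p : B → Prop} {i : Fin m} {b b' : {b // p b}} :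
    (C.restrict p).f i b = some b' ↔ C.f i b.1 = some b'.1 := by
  simp only [restrict, Option.bind_eq_some_iff]
  constructor
  · rintro ⟨x, hx, hh⟩
    split_ifs at hh with hp
    rw [← Option.some.inj hh]; exact hx
  · intro hx
    exact ⟨b'.1, hx, by simp [b'.2]⟩

theorem restrict_e_eq {C : CrystalData m B} {p : B → Prop} {i : Fin m} {b b' : {b // p b}} :
    (C.restrict p).e i b = some b' ↔ C.e i b.1 = some b'.1 := by
  simp only [restrict, Option.bind_eq_some_iff]
  constructor
  · rintro ⟨x, hx, hh⟩
    split_ifs at hh with hp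
    rw [← Option.some.inj hh]; exact hx
  · intro hx
    exact ⟨b'.1, hx, by simp [b'.2]⟩

theorem restrict_seminormal {C : CrystalData m B} (h : C.Seminormal) (p : B → Prop)
    (hf : ∀ i b b', p b → C.f i b = some b' → p b')
    (he : ∀ i b b', p b → C.e i b = some b' → p b') :
    (C.restrict p).Seminormal ∧ (∀ i b, (C.restrict p).eps i b = C.eps i b.1) ∧
    ∀ i b, (C.restrict p).phi i b = C.phi i b.1 := by
  apply seminormal_of
  · intro i a b
    rw [restrict_f_eq, restrict_e_eq, h.inv]
  · intro i b
    rw [← h.e_none]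
    rcases hb : C.e i b.1 with _ | x
    · simp [restrict, hb]
    · have : (C.restrict p).e i b = some ⟨x, he i _ _ b.2 hb⟩ := restrict_e_eq.2 hb
      simp [this]
  · intro i b
    rw [← h.f_none]
    rcases hb : C.f i b.1 with _ | x
    · simp [restrict, hb]
    · have : (C.restrict p).f i b = some ⟨x, hf i _ _ b.2 hb⟩ := restrict_f_eq.2 hb
      simp [this]
  · intro i b b' hb
    exact h.eps_f _ _ _ (restrict_f_eq.1 hb)
  · intro i b b' hb
    exact h.phi_f _ _ _ (restrict_f_eq.1 hb)

theorem tensorPower_zero_seminormal (C : CrystalData m B) :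
    (C.tensorPower 0).Seminormal ∧ (∀ i b, (C.tensorPower 0).eps i b = 0) ∧
      ∀ i b, (C.tensorPower 0).phi i b = 0 := by
  apply seminormal_of <;> simp [tensorPower]

theorem tensorPower_seminormal {C : CrystalData m B} (h : C.Seminormal) (n : ℕ) :
    (C.tensorPower n).Seminormal := by
  induction n with
  | zero => exact (tensorPower_zero_seminormal C).1
  | succ n ih => exact (transport_seminormal (tensor_seminormal h ih).1 _).1

theorem tensorPower_eps_cons {C : CrystalData m B} (h : C.Seminormal) {n : ℕ} (i : Fin m) (a : B)
    (b : Fin n → B) : (C.tensorPower (n + 1)).eps i (Fin.cons a b) =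
      (C.tensorPower n).eps i b + (C.eps i a - (C.tensorPower n).phi i b) := by
  have h1 := tensor_seminormal h (tensorPower_seminormal h n)
  have h2 := (transport_seminormal h1.1 (Fin.consEquiv (fun _ : Fin (n + 1) => B))).2.1 i
    (Fin.cons a b)
  rw [h1.2.1] at h2
  simpa [tensorPower, Fin.consEquiv] using h2

theorem tensorPower_phi_cons {C : CrystalData m B} (h : C.Seminormal) {n : ℕ} (i : Fin m) (a : B)
    (b : Fin n → B) : (C.tensorPower (n + 1)).phi i (Fin.cons a b) =
      C.phi i a + ((C.tensorPower n).phi i b - C.eps i a) := by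
  have h1 := tensor_seminormal h (tensorPower_seminormal h n)
  have h2 := (transport_seminormal h1.1 (Fin.consEquiv (fun _ : Fin (n + 1) => B))).2.2 i
    (Fin.cons a b)
  rw [h1.2.2] at h2
  simpa [tensorPower, Fin.consEquiv] using h2

theorem tensorPower_f_cons (C : CrystalData m B) {n : ℕ} (i : Fin m) (a : B) (b : Fin n → B) :
    (C.tensorPower (n + 1)).f i (Fin.cons a b) =
      if C.eps i a < (C.tensorPower n).phi i b then
        ((C.tensorPower n).f i b).map (fun x => (Fin.cons a x : Fin (n + 1) → B))
      else (C.f i a).map (fun x => (Fin.cons x b : Fin (n + 1) → B)) := by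
  simp only [tensorPower, transport, tensor, Fin.consEquiv, Equiv.coe_fn_symm_mk, Fin.cons_zero,
    Fin.tail_cons, Equiv.coe_fn_mk]
  split_ifs <;> simp [Option.map_map, Function.comp_def]

theorem tensorPower_e_cons (C : CrystalData m B) {n : ℕ} (i : Fin m) (a : B) (b : Fin n → B) :
    (C.tensorPower (n + 1)).e i (Fin.cons a b) =
      if C.eps i a ≤ (C.tensorPower n).phi i b then
        ((C.tensorPower n).e i b).map (fun x => (Fin.cons a x : Fin (n + 1) → B))
      else (C.e i a).map (fun x => (Fin.cons x b : Fin (n + 1) → B)) := by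
  simp only [tensorPower, transport, tensor, Fin.consEquiv, Equiv.coe_fn_symm_mk, Fin.cons_zero,
    Fin.tail_cons, Equiv.coe_fn_mk]
  split_ifs <;> simp [Option.map_map, Function.comp_def]

theorem tensorPower_wt_cons (C : CrystalData m B) {n : ℕ} (a : B) (b : Fin n → B) :
    (C.tensorPower (n + 1)).wt (Fin.cons a b) = C.wt a + (C.tensorPower n).wt b := by
  simp [tensorPower, transport, tensor, Fin.consEquiv]

end CrystalData

/-! ### The vector crystal and row words -/

namespace Letter

variable {m : ℕ}

theorem le_def (a b : Letter m) : a ≤ b ↔ Letter.le a b := Iff.rfl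

/-- `ε_i` on the vector crystal. -/
def eps (i : Fin m) (a : Letter m) : ℕ := if raise i a = none then 0 else 1

/-- `φ_i` on the vector crystal. -/
def phi (i : Fin m) (a : Letter m) : ℕ := if lower i a = none then 0 else 1

theorem raise_of_lower {i : Fin m} {a b : Letter m} (h : lower i a = some b) :
    raise i a = none := by
  cases a <;> simp only [raise, lower] at * <;> split_ifs at * <;>
    simp [Fin.ext_iff] at * <;> omega

theorem lower_of_lower {i : Fin m} {a b : Letter m} (h : lower i a = some b) :
    lower i b = none := by
  cases a <;> simp only [lower] at h <;> split_ifs at h <;>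
    simp only [Option.some.injEq] at h <;> subst h <;> simp only [lower] <;>
    split_ifs <;> simp [Fin.ext_iff] at *

theorem le_of_lower (hm : 2 ≤ m) {i : Fin m} {a b : Letter m} (h : lower i a = some b) :
    a ≤ b := by
  rw [le_def]
  cases a <;> simp only [lower] at h <;> split_ifs at h <;>
    simp only [Option.some.injEq] at h <;> subst h <;>
    simp only [Letter.le, Fin.ext_iff, Fin.le_def] at * <;> omega

/-- Such an h is either a itself or the letter m or m̄ that is incomparable to a'; in both cases an
i-arrow starts at h. -/
theorem lower_ne_none_of_le (hm : 2 ≤ m) {i : Fin m} {a a' h : Letter m} (ha : lower i a = some a')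
    (hah : a ≤ h) (hn : ¬ a' ≤ h) : lower i h ≠ none := by
  rw [le_def] at hah hn
  cases a <;> simp only [lower] at ha <;> split_ifs at ha <;>
    simp only [Option.some.injEq] at ha <;> subst ha <;> cases h <;>
    simp only [Letter.le, Fin.ext_iff, Fin.le_def, lower] at * <;> split_ifs <;> simp <;> omega

theorem le_raise (hm : 2 ≤ m) {i : Fin m} {a h h' : Letter m} (hh : raise i h = some h')
    (hah : a ≤ h) (hn : raise i a = none) : a ≤ h' := by
  rw [le_def] at *
  cases h <;> simp only [raise] at hh <;> split_ifs at hh <;>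
    simp only [Option.some.injEq] at hh <;> subst hh <;> cases a <;>
    simp only [Letter.le, Fin.ext_iff, Fin.le_def, raise] at * <;> split_ifs at hn <;>
    simp at * <;> omega

end Letter

section RowWords

variable {m : ℕ}

theorem vectorCrystal_seminormal (hm : 2 ≤ m) :
    (vectorCrystal m).Seminormal ∧ (∀ i b, (vectorCrystal m).eps i b = Letter.eps i b) ∧
    ∀ i b, (vectorCrystal m).phi i b = Letter.phi i b := by
  apply CrystalData.seminormal_of
  · exact Letter.raise_eq_some_iff hm
  · intro i b; simp [vectorCrystal, Letter.eps]
  · intro i b; simp [vectorCrystal, Letter.phi]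
  · intro i b b' h
    have h1 := Letter.raise_of_lower h
    have h2 := (Letter.raise_eq_some_iff hm i b' b).2 h
    simp [Letter.eps, h1, h2]
  · intro i b b' h
    have h1 := Letter.lower_of_lower h
    have h2 : Letter.lower i b = some b' := h
    simp [Letter.phi, h1, h2]

/-- The crystal of words of length `n`. -/
noncomputable abbrev wordCrystal (m n : ℕ) : CrystalData m (Fin n → Letter m) :=
  (vectorCrystal m).tensorPower n

theorem wordCrystal_seminormal (hm : 2 ≤ m) (n : ℕ) : (wordCrystal m n).Seminormal :=
  CrystalData.tensorPower_seminormal (vectorCrystal_seminormal hm).1 n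

theorem wordCrystal_eps_cons (hm : 2 ≤ m) {n : ℕ} (i : Fin m) (a : Letter m)
    (b : Fin n → Letter m) :
    (wordCrystal m (n + 1)).eps i (Fin.cons a b) =
      (wordCrystal m n).eps i b + (Letter.eps i a - (wordCrystal m n).phi i b) := by
  rw [CrystalData.tensorPower_eps_cons (vectorCrystal_seminormal hm).1,
    (vectorCrystal_seminormal hm).2.1]

theorem wordCrystal_phi_cons (hm : 2 ≤ m) {n : ℕ} (i : Fin m) (a : Letter m)
    (b : Fin n → Letter m) :
    (wordCrystal m (n + 1)).phi i (Fin.cons a b) =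
      Letter.phi i a + ((wordCrystal m n).phi i b - Letter.eps i a) := by
  rw [CrystalData.tensorPower_phi_cons (vectorCrystal_seminormal hm).1,
    (vectorCrystal_seminormal hm).2.1, (vectorCrystal_seminormal hm).2.2]

theorem monotone_cons_iff {n : ℕ} (a : Letter m) (b : Fin n → Letter m) :
    Monotone (Fin.cons a b : Fin (n + 1) → Letter m) ↔ (∀ k, a ≤ b k) ∧ Monotone b := by
  constructor
  · intro h
    refine ⟨fun k => by simpa using h (Fin.zero_le k.succ), fun k l hkl => ?_⟩
    simpa using h (Fin.succ_le_succ_iff.2 hkl)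
  · rintro ⟨h1, h2⟩ k l hkl
    induction k using Fin.cases with
    | zero =>
      induction l using Fin.cases with
      | zero => exact le_rfl
      | succ l => simpa using h1 l
    | succ k =>
      induction l using Fin.cases with
      | zero => exact absurd hkl (by simp)
      | succ l => simpa using h2 (Fin.succ_le_succ_iff.1 hkl)

theorem forall_le_cons_iff {n : ℕ} (c a : Letter m) (b : Fin n → Letter m) :
    (∀ k, c ≤ (Fin.cons a b : Fin (n + 1) → Letter m) k) ↔ c ≤ a ∧ ∀ k, c ≤ b k := by
  rw [Fin.forall_fin_succ]; simp

/-- This is the situation in which f_i acts on a letter a in front of b: as φ_i(b) = 0, no i-arrow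
starts at the first letter of b, so that letter is already above a'. -/
theorem forall_le_of_phi_eq_zero (hm : 2 ≤ m) {n : ℕ} {i : Fin m} {a a' : Letter m}
    (ha : Letter.lower i a = some a') (b : Fin n → Letter m) (hb : Monotone b)
    (hab : ∀ k, a ≤ b k) (h0 : (wordCrystal m n).phi i b = 0) : ∀ k, a' ≤ b k := by
  cases n with
  | zero => intro k; exact k.elim0
  | succ n =>
    induction b using Fin.consCases with
    | cons h t =>
      rw [wordCrystal_phi_cons hm] at h0
      rw [monotone_cons_iff] at hb
      have hah : a ≤ h := by simpa using hab 0
      have h' : a' ≤ h := by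
        by_contra hn
        have := Letter.lower_ne_none_of_le hm ha hah hn
        simp [Letter.phi, this] at h0
      rw [forall_le_cons_iff]
      exact ⟨h', fun k => h'.trans (hb.1 k)⟩

theorem wordCrystal_f_monotone (hm : 2 ≤ m) {n : ℕ} (i : Fin m) (b b' : Fin n → Letter m)
    (hb : Monotone b) (hf : (wordCrystal m n).f i b = some b') :
    Monotone b' ∧ ∀ c, (∀ k, c ≤ b k) → ∀ k, c ≤ b' k := by
  induction n with
  | zero => simp [CrystalData.tensorPower] at hf
  | succ n ih =>
    induction b using Fin.consCases with
    | cons h t =>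
      rw [CrystalData.tensorPower_f_cons] at hf
      rw [monotone_cons_iff] at hb
      split_ifs at hf with hc
      · simp only [Option.map_eq_some_iff] at hf
        obtain ⟨x, hx, rfl⟩ := hf
        obtain ⟨h1, h2⟩ := ih t x hb.2 hx
        refine ⟨(monotone_cons_iff _ _).2 ⟨h2 _ hb.1, h1⟩, fun c => ?_⟩
        simp only [forall_le_cons_iff]
        exact fun hh => ⟨hh.1, h2 _ hh.2⟩
      · simp only [Option.map_eq_some_iff] at hf
        obtain ⟨x, hx, rfl⟩ := hf
        replace hx : Letter.lower i h = some x := hx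
        have h0 : (wordCrystal m n).phi i t = 0 := by
          rw [(vectorCrystal_seminormal hm).2.1] at hc
          simpa [Letter.eps, Letter.raise_of_lower hx] using hc
        have h1 := forall_le_of_phi_eq_zero hm hx t hb.2 hb.1 h0
        refine ⟨(monotone_cons_iff _ _).2 ⟨h1, hb.2⟩, fun c => ?_⟩
        simp only [forall_le_cons_iff]
        exact fun hh => ⟨hh.1.trans (Letter.le_of_lower hm hx), hh.2⟩

/-- The condition ε_i(c) ≤ φ_i(b) says that in c ⊗ b the operator e_i acts on b and not on c. Only
then must c remain a lower bound. -/
theorem wordCrystal_e_monotone (hm : 2 ≤ m) {n : ℕ} (i : Fin m) (b b' : Fin n → Letter m)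
    (hb : Monotone b) (he : (wordCrystal m n).e i b = some b') :
    Monotone b' ∧ ∀ c, (∀ k, c ≤ b k) → Letter.eps i c ≤ (wordCrystal m n).phi i b →
      ∀ k, c ≤ b' k := by
  induction n with
  | zero => simp [CrystalData.tensorPower] at he
  | succ n ih =>
    induction b using Fin.consCases with
    | cons h t =>
      rw [CrystalData.tensorPower_e_cons, (vectorCrystal_seminormal hm).2.1] at he
      rw [monotone_cons_iff] at hb
      rw [wordCrystal_phi_cons hm]
      simp only [forall_le_cons_iff]
      split_ifs at he with hc
      · simp only [Option.map_eq_some_iff] at he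
        obtain ⟨x, hx, rfl⟩ := he
        obtain ⟨h1, h2⟩ := ih t x hb.2 hx
        have h3 := h2 h hb.1 hc
        refine ⟨(monotone_cons_iff _ _).2 ⟨h3, h1⟩, fun c hh _ => ?_⟩
        simp only [forall_le_cons_iff]
        exact ⟨hh.1, fun k => hh.1.trans (h3 k)⟩
      · simp only [Option.map_eq_some_iff] at he
        obtain ⟨x, hx, rfl⟩ := he
        replace hx : Letter.raise i h = some x := hx
        have hl := (Letter.raise_eq_some_iff hm i h x).1 hx
        have hxh := Letter.le_of_lower hm hl
        refine ⟨(monotone_cons_iff _ _).2 ⟨fun k => hxh.trans (hb.1 k), hb.2⟩, fun c hh hcc => ?_⟩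
        simp only [forall_le_cons_iff]
        refine ⟨Letter.le_raise hm hx hh.1 ?_, hh.2⟩
        by_contra hne
        change ¬ Letter.eps i h ≤ (wordCrystal m n).phi i t at hc
        have h1 : Letter.eps i c = 1 := if_neg hne
        have h2 : Letter.eps i h = 1 := if_neg (by simp [hx])
        have h3 : Letter.phi i h = 0 := if_pos (Letter.lower_of_lower hl)
        omega

theorem rowCrystal_seminormal (hm : 2 ≤ m) (n : ℕ) :
    (rowCrystal m n).Seminormal ∧
    (∀ i b, (rowCrystal m n).eps i b = (wordCrystal m n).eps i b.1) ∧
    ∀ i b, (rowCrystal m n).phi i b = (wordCrystal m n).phi i b.1 :=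
  CrystalData.restrict_seminormal (wordCrystal_seminormal hm n) _
    (fun i b b' hb h => (wordCrystal_f_monotone hm i b b' hb h).1)
    (fun i b b' hb h => (wordCrystal_e_monotone hm i b b' hb h).1)

/-! ### Multiplicities of letters -/

open Classical in
/-- The multiplicity of the letter `c` in a word. -/
noncomputable def mult {n : ℕ} (b : Fin n → Letter m) (c : Letter m) : ℕ :=
  ∑ k, if b k = c then 1 else 0

open Classical in
theorem mult_cons {n : ℕ} (a : Letter m) (b : Fin n → Letter m) (c : Letter m) :
    mult (Fin.cons a b : Fin (n + 1) → Letter m) c = (if a = c then 1 else 0) + mult b c := by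
  simp only [mult, Fin.sum_univ_succ, Fin.cons_zero, Fin.cons_succ]

theorem mult_zero (b : Fin 0 → Letter m) (c : Letter m) : mult b c = 0 := by simp [mult]

theorem mult_eq_zero_of_forall_le {n : ℕ} {a : Letter m} {b : Fin n → Letter m}
    (h : ∀ k, a ≤ b k) {c : Letter m} (hc : ¬ a ≤ c) : mult b c = 0 := by
  classical
  simp only [mult, Finset.sum_eq_zero_iff, Finset.mem_univ, forall_const]
  intro k
  rw [if_neg]
  rintro rfl
  exact hc (h k)

/-- A weakly increasing word is a chain, and m, m̄ are incomparable. This is why the last column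
never carries a defect. -/
theorem mult_last {n : ℕ} {b : Fin n → Letter m} (hb : Monotone b) (k : Fin m)
    (hk : k.1 + 1 = m) : mult b (.pos k) = 0 ∨ mult b (.bar k) = 0 := by
  classical
  by_contra! h
  obtain ⟨i, -, hi⟩ := Finset.exists_ne_zero_of_sum_ne_zero h.1
  obtain ⟨j, -, hj⟩ := Finset.exists_ne_zero_of_sum_ne_zero h.2
  simp only [ne_eq, ite_eq_right_iff, one_ne_zero, imp_false, not_not] at hi hj
  rcases le_total i j with hij | hij <;> have := hb hij <;> rw [hi, hj] at this <;>
    simp [Letter.le_def, Letter.le, hk] at this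

open Classical in
theorem mult_f {n : ℕ} (i : Fin m) (b b' : Fin n → Letter m)
    (hf : (wordCrystal m n).f i b = some b') :
    ∃ a a', Letter.lower i a = some a' ∧
      ∀ c, mult b' c + (if a = c then 1 else 0) = mult b c + (if a' = c then 1 else 0) := by
  induction n with
  | zero => simp [CrystalData.tensorPower] at hf
  | succ n ih =>
    induction b using Fin.consCases with
    | cons h t =>
      rw [CrystalData.tensorPower_f_cons] at hf
      split_ifs at hf with hc
      · simp only [Option.map_eq_some_iff] at hf
        obtain ⟨x, hx, rfl⟩ := hf
        obtain ⟨a, a', h1, h2⟩ := ih t x hx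
        refine ⟨a, a', h1, fun c => ?_⟩
        rw [mult_cons, mult_cons]
        have := h2 c
        omega
      · simp only [Option.map_eq_some_iff] at hf
        obtain ⟨x, hx, rfl⟩ := hf
        refine ⟨h, x, hx, fun c => ?_⟩
        rw [mult_cons, mult_cons]
        omega

theorem wordCrystal_wt {n : ℕ} (b : Fin n → Letter m) (k : Fin m) :
    (wordCrystal m n).wt b k = (mult b (.pos k) : ℤ) - mult b (.bar k) := by
  classical
  induction n with
  | zero => simp [CrystalData.tensorPower, mult_zero]
  | succ n ih =>
    induction b using Fin.consCases with
    | cons h t =>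
      rw [CrystalData.tensorPower_wt_cons, Pi.add_apply, ih, mult_cons, mult_cons]
      cases h with
      | pos j =>
        by_cases hjk : j = k
        · subst hjk; simp [vectorCrystal, Letter.wt]; ring
        · simp [vectorCrystal, Letter.wt, hjk, Ne.symm hjk]
      | bar j =>
        by_cases hjk : j = k
        · subst hjk; simp [vectorCrystal, Letter.wt]; ring
        · simp [vectorCrystal, Letter.wt, hjk, Ne.symm hjk]

theorem sum_mult {n : ℕ} (b : Fin n → Letter m) :
    ∑ k, (mult b (.pos k) + mult b (.bar k)) = n := by
  classical
  induction n with
  | zero => simp [mult_zero]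
  | succ n ih =>
    induction b using Fin.consCases with
    | cons h t =>
      have : ∀ k, mult (Fin.cons h t : Fin (n + 1) → Letter m) (.pos k) +
          mult (Fin.cons h t : Fin (n + 1) → Letter m) (.bar k) =
          ((if h = .pos k then 1 else 0) + (if h = .bar k then 1 else 0)) +
          (mult t (.pos k) + mult t (.bar k)) := by
        intro k; rw [mult_cons, mult_cons]; ring
      simp only [this, Finset.sum_add_distrib (g := fun k => mult t (.pos k) + mult t (.bar k)), ih]
      cases h <;> simp [add_comm]

/-- The signature rule for a row: letters i+1 cancel against letters bar(i+1), and truncated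
subtraction counts what is left over. In the induction, monotonicity removes from the tail every
letter that is not above the first one, so the truncations stay consistent. -/
theorem wordCrystal_string {n : ℕ} (hm : 2 ≤ m) (i : Fin m) (hi : i.1 + 1 < m)
    (b : Fin n → Letter m) (hb : Monotone b) :
    (wordCrystal m n).eps i b = mult b (.bar i) +
        (mult b (.pos ⟨i.1 + 1, hi⟩) - mult b (.bar ⟨i.1 + 1, hi⟩)) ∧
      (wordCrystal m n).phi i b = mult b (.pos i) +
        (mult b (.bar ⟨i.1 + 1, hi⟩) - mult b (.pos ⟨i.1 + 1, hi⟩)) := by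
  classical
  induction n with
  | zero =>
    have h := CrystalData.tensorPower_zero_seminormal (vectorCrystal m)
    simp [mult_zero, h.2.1, h.2.2]
  | succ n ih =>
    induction b using Fin.consCases with
    | cons a t =>
      rw [monotone_cons_iff] at hb
      obtain ⟨ih1, ih2⟩ := ih t hb.2
      rw [wordCrystal_eps_cons hm, wordCrystal_phi_cons hm, ih1, ih2]
      simp only [mult_cons]
      have hz : ∀ L, ¬ a ≤ L → mult t L = 0 := fun L => mult_eq_zero_of_forall_le hb.1
      have z1 := hz (.pos i)
      have z2 := hz (.bar ⟨i.1 + 1, hi⟩)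
      have z3 := hz (.pos ⟨i.1 + 1, hi⟩)
      clear hz ih ih1 ih2 hb
      cases a with
      | pos k =>
        simp only [Letter.le_def, Letter.le, Fin.le_def] at z1 z2 z3
        simp only [Letter.eps, Letter.phi, Letter.raise, Letter.lower, hi, Letter.pos.injEq,
          reduceCtorEq, Fin.ext_iff, if_false, dif_pos, true_and]
        by_cases h1 : k.1 = i.1
        · simp [h1]; omega
        · by_cases h2 : k.1 = i.1 + 1
          · simp [h2]; omega
          · simp [h1, h2]
      | bar k =>
        simp only [Letter.le_def, Letter.le, Fin.le_def, not_false_eq_true,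
          forall_const] at z1 z2 z3
        simp only [Letter.eps, Letter.phi, Letter.raise, Letter.lower, hi, Letter.bar.injEq,
          reduceCtorEq, Fin.ext_iff, if_false, dif_pos, true_and]
        by_cases h1 : k.1 = i.1
        · simp [h1]; omega
        · by_cases h2 : k.1 = i.1 + 1
          · simp [h2]; omega
          · simp [h1, h2]

/-- Exchanging m with m̄ turns the arrows of the last node into those of the node before it, so the
formula is the previous one with these two multiplicities exchanged. -/
theorem wordCrystal_string_last {n : ℕ} (hm : 2 ≤ m) (i c : Fin m) (hi : i.1 + 1 = m)
    (hc : c.1 + 1 = i.1) (b : Fin n → Letter m) (hb : Monotone b) :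
    (wordCrystal m n).eps i b = mult b (.bar c) + (mult b (.bar i) - mult b (.pos i)) ∧
      (wordCrystal m n).phi i b = mult b (.pos c) + (mult b (.pos i) - mult b (.bar i)) := by
  classical
  induction n with
  | zero =>
    have h := CrystalData.tensorPower_zero_seminormal (vectorCrystal m)
    simp [mult_zero, h.2.1, h.2.2]
  | succ n ih =>
    induction b using Fin.consCases with
    | cons a t =>
      rw [monotone_cons_iff] at hb
      obtain ⟨ih1, ih2⟩ := ih t hb.2
      rw [wordCrystal_eps_cons hm, wordCrystal_phi_cons hm, ih1, ih2]
      simp only [mult_cons]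
      have hz : ∀ L, ¬ a ≤ L → mult t L = 0 := fun L => mult_eq_zero_of_forall_le hb.1
      have z1 := hz (.pos i)
      have z2 := hz (.bar i)
      have z3 := hz (.pos c)
      clear hz ih ih1 ih2 hb
      have hi' : ¬ i.1 + 1 < m := by omega
      cases a with
      | pos k =>
        simp only [Letter.le_def, Letter.le, Fin.le_def] at z1 z2 z3
        simp only [Letter.eps, Letter.phi, Letter.raise, Letter.lower, hi', Letter.pos.injEq,
          reduceCtorEq, Fin.ext_iff, if_false, dif_neg, false_and, not_false_eq_true]
        by_cases h1 : k.1 = i.1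
        · have h2 : ¬ i.1 + 2 = m := by omega
          have h3 : ¬ i.1 = c.1 := by omega
          simp [h1, h2, h3]; omega
        · by_cases h2 : k.1 = c.1
          · have h4 : c.1 + 2 = m := by omega
            have h3 : ¬ c.1 = i.1 := by omega
            simp [h2, h3, h4]; omega
          · have h4 : ¬ k.1 + 2 = m := by omega
            simp [h1, h2, h4]
      | bar k =>
        simp only [Letter.le_def, Letter.le, Fin.le_def, not_false_eq_true,
          forall_const] at z1 z2 z3
        simp only [Letter.eps, Letter.phi, Letter.raise, Letter.lower, hi', Letter.bar.injEq,
          reduceCtorEq, Fin.ext_iff, if_false, dif_neg, false_and, not_false_eq_true]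
        by_cases h1 : k.1 = i.1
        · have h2 : ¬ i.1 + 2 = m := by omega
          have h3 : ¬ i.1 = c.1 := by omega
          simp [h1, h3]; omega
        · by_cases h2 : k.1 = c.1
          · have h4 : c.1 + 2 = m := by omega
            have h3 : ¬ c.1 = i.1 := by omega
            simp [h2, h3, h4]; omega
          · have h4 : ¬ k.1 + 2 = m := by omega
            simp [h1, h2, h4]

end RowWords

/-! ### Coordinates on row tableaux -/

section Coordinates

variable {m n : ℕ}

/-- The index `c` for which `α_j = ε_c ∓ ε_{c'}` with `c < c'`. -/
def nodeCol (j : Fin m) : Fin m := if j.1 + 1 < m then j else ⟨j.1 - 1, by omega⟩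

/-- The value of `± ε_{c'}`, where `α_j = ε_c - (± ε_{c'})`. -/
def nodeSnd (j : Fin m) (z : Fin m → ℤ) : ℤ := if h : j.1 + 1 < m then z ⟨j.1 + 1, h⟩ else - z j

theorem simpleRoot_dotProduct (hm : 2 ≤ m) (j : Fin m) (z : Fin m → ℤ) :
    simpleRoot j ⬝ᵥ z = z (nodeCol j) - nodeSnd j z := by
  by_cases h : j.1 + 1 < m
  · have : simpleRoot j = Pi.single j 1 - Pi.single ⟨j.1 + 1, h⟩ 1 := by
      ext k
      simp only [simpleRoot, h, if_true, Pi.sub_apply, Pi.single_apply, Fin.ext_iff]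
      split_ifs <;> omega
    rw [this, sub_dotProduct]
    simp [nodeCol, nodeSnd, h]
  · have : simpleRoot j = Pi.single (nodeCol j) 1 + Pi.single j 1 := by
      ext k
      simp only [simpleRoot, h, if_false, Pi.add_apply, Pi.single_apply, Fin.ext_iff, nodeCol]
      split_ifs <;> omega
    rw [this, add_dotProduct]
    simp [nodeSnd, h]

theorem simpleRoot_nodeCol (hm : 2 ≤ m) (j : Fin m) : simpleRoot j (nodeCol j) = 1 := by
  unfold nodeCol
  split_ifs with h
  · simp [simpleRoot]
  · simp [simpleRoot, h, Fin.ext_iff]; omega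

theorem nodeSnd_simpleRoot (j : Fin m) : nodeSnd j (simpleRoot j) = -1 := by
  unfold nodeSnd
  split_ifs with h <;> simp [simpleRoot, h, Fin.ext_iff]

theorem nodeSnd_sub (j : Fin m) (z v : Fin m → ℤ) :
    nodeSnd j (z - v) = nodeSnd j z - nodeSnd j v := by
  unfold nodeSnd; split_ifs <;> simp; ring

/-- The number of pairs `k, k̄` in a row tableau. -/
noncomputable def defect (b : RowTableau m n) (k : Fin m) : ℕ :=
  min (mult b.1 (.pos k)) (mult b.1 (.bar k))

theorem rowCrystal_wt (b : RowTableau m n) (k : Fin m) :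
    (rowCrystal m n).wt b k = (mult b.1 (.pos k) : ℤ) - mult b.1 (.bar k) :=
  wordCrystal_wt b.1 k

theorem defect_last (b : RowTableau m n) (k : Fin m) (hk : k.1 + 1 = m) : defect b k = 0 := by
  have := mult_last b.2 k hk
  unfold defect
  omega

/-- Column by column, #k + #k̄ = |z_k| + 2 d_k. -/
theorem sum_abs_wt_add_defect (b : RowTableau m n) :
    ∑ k, |(rowCrystal m n).wt b k| + 2 * ∑ k, (defect b k : ℤ) = n := by
  have hn := congrArg (Nat.cast : ℕ → ℤ) (sum_mult b.1)
  rw [← hn, Finset.mul_sum, ← Finset.sum_add_distrib, Nat.cast_sum]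
  refine Finset.sum_congr rfl fun k _ => ?_
  rw [rowCrystal_wt]
  unfold defect
  push_cast
  rcases abs_cases ((mult b.1 (.pos k) : ℤ) - mult b.1 (.bar k)) with h | h <;>
    rcases min_cases (mult b.1 (.pos k) : ℤ) (mult b.1 (.bar k)) with h' | h' <;> omega

theorem mult_pos_eq (b : RowTableau m n) (k : Fin m) :
    mult b.1 (.pos k) = defect b k + ((rowCrystal m n).wt b k).toNat := by
  rw [rowCrystal_wt]; unfold defect; omega

theorem mult_bar_eq (b : RowTableau m n) (k : Fin m) :
    mult b.1 (.bar k) = defect b k + (-(rowCrystal m n).wt b k).toNat := by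
  rw [rowCrystal_wt]; unfold defect; omega

/-- The defect of the second column cancels in the difference of its two multiplicities, so node j
sees only the defect of `nodeCol j`. -/
theorem rowCrystal_string (hm : 2 ≤ m) (j : Fin m) (b : RowTableau m n) :
    (rowCrystal m n).eps j b = defect b (nodeCol j) +
      (-(rowCrystal m n).wt b (nodeCol j)).toNat + (nodeSnd j ((rowCrystal m n).wt b)).toNat ∧
    (rowCrystal m n).phi j b = defect b (nodeCol j) +
      ((rowCrystal m n).wt b (nodeCol j)).toNat + (-nodeSnd j ((rowCrystal m n).wt b)).toNat := by
  rw [(rowCrystal_seminormal hm n).2.1, (rowCrystal_seminormal hm n).2.2]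
  by_cases h : j.1 + 1 < m
  · obtain ⟨h1, h2⟩ := wordCrystal_string hm j h b.1 b.2
    rw [h1, h2, mult_pos_eq, mult_pos_eq, mult_bar_eq, mult_bar_eq]
    simp only [nodeCol, nodeSnd, h, if_true, dif_pos]
    omega
  · have hc : (nodeCol j).1 + 1 = j.1 := by simp only [nodeCol, h, if_false]; omega
    obtain ⟨h1, h2⟩ := wordCrystal_string_last hm j (nodeCol j) (by omega) hc b.1 b.2
    rw [h1, h2, mult_pos_eq, mult_pos_eq, mult_bar_eq, mult_bar_eq]
    simp only [nodeSnd, h, dif_neg, not_false_eq_true]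
    omega

/-! ### Rows correspond to their weights and defects -/

open Classical in
theorem count_ofFn {n : ℕ} (b : Fin n → Letter m) (c : Letter m) :
    (List.ofFn b).count c = mult b c := by
  induction n with
  | zero => simp [mult]
  | succ n ih =>
    induction b using Fin.consCases with
    | cons h t =>
      rw [mult_cons, List.ofFn_succ, List.count_cons]
      simp only [Fin.cons_zero, Fin.cons_succ, beq_iff_eq]
      rw [← ih t, add_comm]

/-- Weight and defects give the multiplicity of every letter, and a sorted list is determined by its
multiset of entries. -/
theorem row_ext {b b' : RowTableau m n} (hw : (rowCrystal m n).wt b = (rowCrystal m n).wt b')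
    (hd : ∀ k, defect b k = defect b' k) : b = b' := by
  classical
  apply Subtype.ext
  apply List.ofFn_injective
  apply List.Perm.eq_of_pairwise (le := (· ≤ ·)) (fun a c _ _ => le_antisymm)
    (List.pairwise_ofFn.2 fun i j h => b.2 h.le) (List.pairwise_ofFn.2 fun i j h => b'.2 h.le)
  rw [List.perm_iff_count]
  intro c
  rw [count_ofFn, count_ofFn]
  cases c with
  | pos k => rw [mult_pos_eq, mult_pos_eq, hw, hd]
  | bar k => rw [mult_bar_eq, mult_bar_eq, hw, hd]

theorem sum_map_finRange {M : Type*} [AddCommMonoid M] (g : Fin m → M) :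
    ((List.finRange m).map g).sum = ∑ k, g k := by
  rw [← List.ofFn_eq_map, List.sum_ofFn]

theorem exists_row_of_mult (x y : Fin m → ℕ) (hlast : ∀ k : Fin m, k.1 + 1 = m → x k = 0 ∨ y k = 0)
    (hn : ∑ k, (x k + y k) = n) :
    ∃ b : RowTableau m n, ∀ k, mult b.1 (.pos k) = x k ∧ mult b.1 (.bar k) = y k := by
  classical
  -- Unbarred letters in increasing order, then barred letters in decreasing order. A letter of the
  -- first block can fail to lie below one of the second only for the pair m, m̄, which `hlast`
  -- excludes.
  set l : List (Letter m) :=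
    (List.finRange m).flatMap (fun k => List.replicate (x k) (Letter.pos k)) ++
    (List.finRange m).reverse.flatMap (fun k => List.replicate (y k) (Letter.bar k)) with hl
  have hsorted : l.Pairwise (· ≤ ·) := by
    rw [hl, List.pairwise_append]
    refine ⟨?_, ?_, ?_⟩
    · rw [List.pairwise_flatMap]
      refine ⟨fun k _ => List.pairwise_replicate.2 (Or.inr le_rfl), ?_⟩
      refine (List.pairwise_lt_finRange m).imp fun {a c} hac u hu v hv => ?_
      rw [List.eq_of_mem_replicate hu, List.eq_of_mem_replicate hv]
      exact hac.le
    · rw [List.pairwise_flatMap]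
      refine ⟨fun k _ => List.pairwise_replicate.2 (Or.inr le_rfl), ?_⟩
      rw [List.pairwise_reverse]
      refine (List.pairwise_lt_finRange m).imp fun {a c} hac u hu v hv => ?_
      rw [List.eq_of_mem_replicate hu, List.eq_of_mem_replicate hv]
      exact hac.le
    · simp only [List.mem_flatMap, List.mem_replicate]
      rintro _ ⟨k, -, hk, rfl⟩ _ ⟨k', -, hk', rfl⟩
      rintro ⟨h1, h2⟩
      obtain rfl : k = k' := Fin.ext (by omega)
      rcases hlast k h1 with h | h <;> contradiction
  have hlen : l.length = n := by
    rw [hl, ← hn]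
    simp [List.length_flatMap, sum_map_finRange, Finset.sum_add_distrib]
  have hpos : ∀ k, l.count (.pos k) = x k := by
    intro k
    rw [hl]
    simp [List.count_flatMap, Function.comp_def, List.count_replicate, sum_map_finRange]
  have hbar : ∀ k, l.count (.bar k) = y k := by
    intro k
    rw [hl]
    simp [List.count_flatMap, Function.comp_def, List.count_replicate, sum_map_finRange]
  clear_value l
  subst hlen
  refine ⟨⟨l.get, fun i j hij => ?_⟩, fun k => ?_⟩
  · rcases hij.eq_or_lt with rfl | h
    · exact le_rfl
    · rw [← List.ofFn_get l, List.pairwise_ofFn] at hsorted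
      exact hsorted h
  · rw [← hpos, ← hbar, ← count_ofFn, ← count_ofFn, List.ofFn_get]
    exact ⟨rfl, rfl⟩

theorem exists_row (z : Fin m → ℤ) (d : Fin m → ℕ) (hd : ∀ k : Fin m, k.1 + 1 = m → d k = 0)
    (hn : ∑ k, |z k| + 2 * ∑ k, (d k : ℤ) = n) :
    ∃ b : RowTableau m n, (rowCrystal m n).wt b = z ∧ defect b = d := by
  obtain ⟨b, hb⟩ := exists_row_of_mult (n := n) (fun k => d k + (z k).toNat)
    (fun k => d k + (-z k).toNat) (fun k hk => by have := hd k hk; omega) (by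
      zify
      rw [← hn, Finset.mul_sum, ← Finset.sum_add_distrib]
      refine Finset.sum_congr rfl fun k _ => ?_
      rcases abs_cases (z k) with h | h <;> omega)
  refine ⟨b, ?_, ?_⟩
  · ext k; rw [rowCrystal_wt, (hb k).1, (hb k).2]; omega
  · ext k; unfold defect; rw [(hb k).1, (hb k).2]; omega

/-- One letter moves along an i-arrow, so only two columns are affected. In the second of them, for
j below the last node, ε_j grows by one only if the change there lies in the uncancelled part, which
leaves the minimum of the two multiplicities unchanged. For the last node the second column is the
last one, whose defect is always zero. -/
theorem row_f_imp (hm : 2 ≤ m) {j : Fin m} {b b' : RowTableau m n}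
    (h : (rowCrystal m n).f j b = some b') :
    (rowCrystal m n).wt b' = (rowCrystal m n).wt b - simpleRoot j ∧
    (rowCrystal m n).eps j b' = (rowCrystal m n).eps j b + 1 ∧
    ∀ k, k ≠ nodeCol j → defect b' k = defect b k := by
  classical
  have heps := (rowCrystal_seminormal hm n).1.eps_f _ _ _ h
  obtain ⟨a, a', ha, hc⟩ := mult_f j b.1 b'.1 (CrystalData.restrict_f_eq.1 h)
  have hwt : (rowCrystal m n).wt b' = (rowCrystal m n).wt b - simpleRoot j := by
    ext k
    have h1 := hc (.pos k)
    have h2 := hc (.bar k)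
    rw [Pi.sub_apply, rowCrystal_wt, rowCrystal_wt]
    cases a <;> simp only [Letter.lower] at ha <;> split_ifs at ha <;>
      simp only [Option.some.injEq] at ha <;> subst ha <;>
      simp only [Letter.pos.injEq, Letter.bar.injEq, reduceCtorEq, if_false, simpleRoot,
        Fin.ext_iff] at * <;> split_ifs at * <;> omega
  refine ⟨hwt, heps, fun k hk => ?_⟩
  by_cases hkl : k.1 + 1 = m
  · rw [defect_last _ _ hkl, defect_last _ _ hkl]
  have h1 := hc (.pos k)
  have h2 := hc (.bar k)
  rw [(rowCrystal_seminormal hm n).2.1, (rowCrystal_seminormal hm n).2.1] at heps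
  unfold defect
  by_cases hj : j.1 + 1 < m
  · rw [(wordCrystal_string hm j hj _ b.2).1, (wordCrystal_string hm j hj _ b'.2).1] at heps
    have h3 := hc (.bar j)
    have hk' : ¬ k.1 = j.1 := by simpa [nodeCol, hj, Fin.ext_iff] using hk
    by_cases hk2 : k = ⟨j.1 + 1, hj⟩
    · subst hk2
      cases a <;> simp only [Letter.lower] at ha <;> split_ifs at ha <;>
        simp only [Option.some.injEq] at ha <;> subst ha <;>
        simp only [Letter.pos.injEq, Letter.bar.injEq, reduceCtorEq, if_false,
          Fin.ext_iff] at * <;> split_ifs at * <;> omega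
    · cases a <;> simp only [Letter.lower] at ha <;> split_ifs at ha <;>
        simp only [Option.some.injEq] at ha <;> subst ha <;>
        simp only [Letter.pos.injEq, Letter.bar.injEq, reduceCtorEq, if_false,
          Fin.ext_iff] at * <;> split_ifs at * <;> omega
  · have hk' : ¬ k.1 = j.1 - 1 := by simpa [nodeCol, hj, Fin.ext_iff] using hk
    cases a <;> simp only [Letter.lower] at ha <;> split_ifs at ha <;>
      simp only [Option.some.injEq] at ha <;> subst ha <;>
      simp only [Letter.pos.injEq, Letter.bar.injEq, reduceCtorEq, if_false,
        Fin.ext_iff] at * <;> split_ifs at * <;> omega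

theorem eps_eq_iff_defect_eq (hm : 2 ≤ m) {b b' : RowTableau m n} (j : Fin m)
    (hw : (rowCrystal m n).wt b = (rowCrystal m n).wt b') :
    (rowCrystal m n).eps j b = (rowCrystal m n).eps j b' ↔
      defect b (nodeCol j) = defect b' (nodeCol j) := by
  rw [(rowCrystal_string hm j b).1, (rowCrystal_string hm j b').1, hw]
  omega

/-- The lowering operators in terms of weights, string lengths and defects. -/
theorem row_f_iff (hm : 2 ≤ m) {j : Fin m} {b b' : RowTableau m n} :
    (rowCrystal m n).f j b = some b' ↔
    (rowCrystal m n).wt b' = (rowCrystal m n).wt b - simpleRoot j ∧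
    (rowCrystal m n).eps j b' = (rowCrystal m n).eps j b + 1 ∧
    ∀ k, k ≠ nodeCol j → defect b' k = defect b k := by
  refine ⟨row_f_imp hm, fun ⟨h1, h2, h3⟩ => ?_⟩
  -- If φ_j(b) were zero, then d_c = 0, z_c ≤ 0 and the value of s would be ≥ 0, so subtracting α_j
  -- would raise ε_j by at least two.
  have hphi : (rowCrystal m n).phi j b ≠ 0 := by
    rw [(rowCrystal_string hm j b').1, (rowCrystal_string hm j b).1, h1, nodeSnd_sub,
      Pi.sub_apply, simpleRoot_nodeCol hm, nodeSnd_simpleRoot] at h2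
    rw [(rowCrystal_string hm j b).2]
    omega
  rcases hf : (rowCrystal m n).f j b with _ | b''
  · exact absurd (((rowCrystal_seminormal hm n).1.f_none j b).1 hf) hphi
  · obtain ⟨g1, g2, g3⟩ := row_f_imp hm hf
    have hw := g1.trans h1.symm
    refine congrArg some (row_ext hw fun k => ?_)
    by_cases hk : k = nodeCol j
    · rw [hk, ← eps_eq_iff_defect_eq hm j hw, g2, h2]
    · rw [g3 k hk, h3 k hk]

theorem row_e_iff (hm : 2 ≤ m) {j : Fin m} {b b' : RowTableau m n} :
    (rowCrystal m n).e j b = some b' ↔ (rowCrystal m n).f j b' = some b :=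
  (rowCrystal_seminormal hm n).1.inv j b b'

end Coordinates

/-! ### Longest elements of parabolic subgroups -/

section Weyl

variable {m : ℕ}

theorem simpleReflection_apply (i : Fin m) (v : Fin m → ℤ) :
    simpleReflection i v = v - (simpleRoot i ⬝ᵥ v) • simpleRoot i := rfl

theorem simpleRoot_dotProduct_self (hm : 2 ≤ m) (i : Fin m) :
    simpleRoot i ⬝ᵥ simpleRoot i = 2 := by
  rw [simpleRoot_dotProduct hm, simpleRoot_nodeCol hm, nodeSnd_simpleRoot]; rfl

theorem simpleReflection_dotProduct (hm : 2 ≤ m) (i : Fin m) (v w : Fin m → ℤ) :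
    simpleReflection i v ⬝ᵥ simpleReflection i w = v ⬝ᵥ w := by
  simp only [simpleReflection_apply, sub_dotProduct, dotProduct_sub, smul_dotProduct,
    dotProduct_smul, smul_eq_mul, simpleRoot_dotProduct_self hm, dotProduct_comm v (simpleRoot i)]
  ring

theorem simpleReflection_mul_self (hm : 2 ≤ m) (i : Fin m) :
    simpleReflection i * simpleReflection i = 1 := by
  refine LinearMap.ext fun v => ?_
  ext k
  simp only [Module.End.mul_apply, simpleReflection_apply, dotProduct_sub, dotProduct_smul,
    simpleRoot_dotProduct_self hm, Pi.sub_apply, Pi.smul_apply, smul_eq_mul, Module.End.one_apply]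
  ring

theorem simpleReflection_simpleRoot (hm : 2 ≤ m) (i : Fin m) :
    simpleReflection i (simpleRoot i) = -simpleRoot i := by
  rw [simpleReflection_apply, simpleRoot_dotProduct_self hm]
  ext k; simp; ring

theorem weylWord_cons (i : Fin m) (l : List (Fin m)) :
    weylWord (i :: l) = simpleReflection i * weylWord l := by simp [weylWord]

theorem weylWord_append (l l' : List (Fin m)) :
    weylWord (l ++ l') = weylWord l * weylWord l' := by simp [weylWord]

theorem weylWord_singleton (i : Fin m) : weylWord [i] = simpleReflection i := by simp [weylWord]

theorem weylWord_dotProduct (hm : 2 ≤ m) (l : List (Fin m)) (v w : Fin m → ℤ) :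
    weylWord l v ⬝ᵥ weylWord l w = v ⬝ᵥ w := by
  induction l with
  | nil => simp [weylWord]
  | cons i l ih =>
    rw [weylWord_cons, Module.End.mul_apply, Module.End.mul_apply,
      simpleReflection_dotProduct hm, ih]

theorem parabolic_dotProduct (hm : 2 ≤ m) {J : Finset (Fin m)} {w : Module.End ℤ (Fin m → ℤ)}
    (hw : w ∈ parabolic J) (v v' : Fin m → ℤ) : w v ⬝ᵥ w v' = v ⬝ᵥ v' := by
  obtain ⟨l, -, rfl⟩ := hw
  exact weylWord_dotProduct hm l v v'

theorem one_mem_parabolic (J : Finset (Fin m)) : 1 ∈ parabolic J :=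
  ⟨[], by simp, by simp [weylWord]⟩

theorem mul_mem_parabolic {J : Finset (Fin m)} {w w' : Module.End ℤ (Fin m → ℤ)}
    (hw : w ∈ parabolic J) (hw' : w' ∈ parabolic J) : w * w' ∈ parabolic J := by
  obtain ⟨l, hl, rfl⟩ := hw
  obtain ⟨l', hl', rfl⟩ := hw'
  refine ⟨l ++ l', fun i hi => ?_, weylWord_append l l'⟩
  rcases List.mem_append.1 hi with h | h
  exacts [hl i h, hl' i h]

theorem simpleReflection_mem_parabolic {J : Finset (Fin m)} {i : Fin m} (hi : i ∈ J) :
    simpleReflection i ∈ parabolic J := ⟨[i], by simpa using hi, weylWord_singleton i⟩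

theorem parabolic_mono {J K : Finset (Fin m)} (h : J ⊆ K) : parabolic J ⊆ parabolic K := by
  rintro _ ⟨l, hl, rfl⟩
  exact ⟨l, fun i hi => h (hl i hi), rfl⟩

/-- A reflection is conjugated to the reflection in the image of the root. -/
theorem mul_simpleReflection_of_dotProduct {w : Module.End ℤ (Fin m → ℤ)}
    (hw : ∀ v v', w v ⬝ᵥ w v' = v ⬝ᵥ v') {i j : Fin m}
    (h : w (simpleRoot j) = simpleRoot i ∨ w (simpleRoot j) = -simpleRoot i) :
    w * simpleReflection j = simpleReflection i * w := by
  refine LinearMap.ext fun v => ?_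
  simp only [Module.End.mul_apply, simpleReflection_apply, map_sub, map_smul]
  rw [← hw (simpleRoot j) v]
  rcases h with h | h <;> simp [h]

/-- The half sum of the positive roots. -/
def rho (k : Fin m) : ℤ := (m : ℤ) - 1 - k.1

theorem simpleRoot_dotProduct_rho (hm : 2 ≤ m) (i : Fin m) : simpleRoot i ⬝ᵥ rho = 1 := by
  rw [simpleRoot_dotProduct hm]
  unfold nodeSnd nodeCol rho
  split_ifs <;> push_cast <;> omega

/-- An integral vector of square length 2 is ±ε_p ± ε_q with p ≠ q, and the entries of `rho` are
distinct and non-negative. The sign of the pairing with `rho` can therefore serve as the definition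
of a positive root. -/
theorem dotProduct_rho_ne_zero {v : Fin m → ℤ} (hv : v ⬝ᵥ v = 2) : v ⬝ᵥ rho ≠ 0 := by
  intro h0
  have hsq : ∀ x : ℤ, 0 ≤ x * x := fun x => mul_self_nonneg x
  have hdiv : ∀ x : ℤ, x ≠ 0 → x * x ≤ 2 → x = 1 ∨ x = -1 := by
    intro x hx h
    have h1 : x ≤ 1 := by nlinarith
    have h2 : -1 ≤ x := by nlinarith
    omega
  obtain ⟨p, hp⟩ : ∃ p, v p ≠ 0 := by
    by_contra! h
    simp [dotProduct, h] at hv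
  have hsum := Finset.add_sum_erase Finset.univ (fun k => v k * v k) (Finset.mem_univ p)
  have hpos := Finset.sum_nonneg (s := Finset.univ.erase p) (f := fun k => v k * v k)
    fun k _ => hsq _
  change _ = v ⬝ᵥ v at hsum
  have hp1 := hdiv _ hp (by linarith)
  have hp2 : v p * v p = 1 := by rcases hp1 with h | h <;> rw [h] <;> norm_num
  have hrest : ∑ k ∈ Finset.univ.erase p, v k * v k = 1 := by
    linarith
  obtain ⟨q, hq, hq0⟩ : ∃ q ∈ Finset.univ.erase p, v q ≠ 0 := by
    by_contra! h
    rw [Finset.sum_eq_zero (fun k hk => by rw [h k hk, mul_zero])] at hrest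
    exact zero_ne_one hrest
  have hsum2 := Finset.add_sum_erase (Finset.univ.erase p) (fun k => v k * v k) hq
  have hpos2 := Finset.sum_nonneg (s := (Finset.univ.erase p).erase q) (f := fun k => v k * v k)
    fun k _ => hsq _
  simp only [hrest] at hsum2
  have hq1 := hdiv _ hq0 (by linarith)
  have hq2 : v q * v q = 1 := by rcases hq1 with h | h <;> rw [h] <;> norm_num
  have hz : ∑ k ∈ (Finset.univ.erase p).erase q, v k * v k = 0 := by linarith
  rw [Finset.sum_eq_zero_iff_of_nonneg fun k _ => hsq _] at hz
  have hh : v ⬝ᵥ rho = v p * rho p + v q * rho q := by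
    unfold dotProduct
    rw [← Finset.add_sum_erase Finset.univ _ (Finset.mem_univ p),
      ← Finset.add_sum_erase (Finset.univ.erase p) _ hq, Finset.sum_eq_zero, add_zero]
    intro k hk
    rw [mul_self_eq_zero.1 (hz k hk), zero_mul]
  have hqp : q.1 ≠ p.1 := fun h => (Finset.mem_erase.1 hq).1 (Fin.ext h)
  have := p.2
  have := q.2
  rw [hh] at h0
  unfold rho at h0
  rcases hp1 with h1 | h1 <;> rcases hq1 with h2 | h2 <;> rw [h1, h2] at h0 <;> omega

/-- A simple reflection permutes the positive roots other than the simple root. -/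
theorem simpleReflection_pos (hm : 2 ≤ m) {v : Fin m → ℤ} {i : Fin m} (hv : v ⬝ᵥ v = 2)
    (hpos : 0 < v ⬝ᵥ rho) (hne : v ≠ simpleRoot i) : 0 < simpleReflection i v ⬝ᵥ rho := by
  -- Since v ≠ α_i, the square length 4 - 2⟨α_i, v⟩ of v - α_i is positive. As ⟨α_i, ρ⟩ = 1,
  -- reflecting lowers the pairing with ρ by at most one, and the result is not zero.
  have hlt : simpleRoot i ⬝ᵥ v ≤ 1 := by
    have h1 : (v - simpleRoot i) ⬝ᵥ (v - simpleRoot i) = 4 - 2 * (simpleRoot i ⬝ᵥ v) := by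
      rw [sub_dotProduct, dotProduct_sub, dotProduct_sub, hv, simpleRoot_dotProduct_self hm,
        dotProduct_comm v]
      ring
    have h2 : (v - simpleRoot i) ⬝ᵥ (v - simpleRoot i) ≠ 0 := by
      rw [Ne, dotProduct_self_eq_zero, sub_eq_zero]; exact hne
    have h3 : 0 ≤ (v - simpleRoot i) ⬝ᵥ (v - simpleRoot i) :=
      Finset.sum_nonneg fun k _ => mul_self_nonneg _
    omega
  have hs : simpleReflection i v ⬝ᵥ rho = v ⬝ᵥ rho - simpleRoot i ⬝ᵥ v := by
    rw [simpleReflection_apply, sub_dotProduct, smul_dotProduct, simpleRoot_dotProduct_rho hm]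
    simp
  have hnz : simpleReflection i v ⬝ᵥ rho ≠ 0 :=
    dotProduct_rho_ne_zero (by rw [simpleReflection_dotProduct hm, hv])
  omega

/-- The exchange condition. -/
theorem exists_exchange (hm : 2 ≤ m) {j : Fin m} (l : List (Fin m))
    (h : weylWord l (simpleRoot j) ⬝ᵥ rho < 0) :
    ∃ l' : List (Fin m), (∀ i ∈ l', i ∈ l) ∧ l'.length + 1 = l.length ∧
      weylWord l = weylWord l' * simpleReflection j := by
  induction l with
  | nil => simp [weylWord, simpleRoot_dotProduct_rho hm] at h
  | cons i l ih =>
    have hn : weylWord l (simpleRoot j) ⬝ᵥ weylWord l (simpleRoot j) = 2 := by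
      rw [weylWord_dotProduct hm, simpleRoot_dotProduct_self hm]
    rcases lt_or_gt_of_ne (dotProduct_rho_ne_zero hn) with hl | hl
    · obtain ⟨l', h1, h2, h3⟩ := ih hl
      refine ⟨i :: l', ?_, by simp [h2], by rw [weylWord_cons, weylWord_cons, h3, mul_assoc]⟩
      intro k hk
      rcases List.mem_cons.1 hk with rfl | hk
      · simp
      · exact List.mem_cons_of_mem _ (h1 k hk)
    -- The sign changes at the letter i, and s_i makes only its own positive root negative.
    -- Conjugation then gives s_i w = w s_j for the tail w, so i is the letter that is deleted.
    · have heq : weylWord l (simpleRoot j) = simpleRoot i := by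
        by_contra hne
        have := simpleReflection_pos hm hn hl hne
        rw [weylWord_cons, Module.End.mul_apply] at h
        omega
      refine ⟨l, fun k hk => List.mem_cons_of_mem _ hk, by simp, ?_⟩
      rw [weylWord_cons,
        mul_simpleReflection_of_dotProduct (weylWord_dotProduct hm l) (Or.inl heq)]

theorem exists_word_of_length (J : Finset (Fin m)) {w : Module.End ℤ (Fin m → ℤ)}
    (hw : w ∈ parabolic J) :
    ∃ l : List (Fin m), (∀ i ∈ l, i ∈ J) ∧ weylWord l = w ∧ l.length = parabolicLength J w := by
  obtain ⟨l, h1, h2⟩ := hw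
  exact Nat.sInf_mem (s := {k | ∃ l : List (Fin m), (∀ i ∈ l, i ∈ J) ∧ weylWord l = w ∧
    l.length = k}) ⟨l.length, l, h1, h2, rfl⟩

theorem parabolicLength_le (J : Finset (Fin m)) (l : List (Fin m)) (hl : ∀ i ∈ l, i ∈ J) :
    parabolicLength J (weylWord l) ≤ l.length :=
  Nat.sInf_le ⟨l, hl, rfl, rfl⟩

theorem parabolicLength_lt (hm : 2 ≤ m) {J : Finset (Fin m)} {w : Module.End ℤ (Fin m → ℤ)}
    (hw : w ∈ parabolic J) {j : Fin m} (hj : j ∈ J) (hpos : 0 < w (simpleRoot j) ⬝ᵥ rho) :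
    parabolicLength J w < parabolicLength J (w * simpleReflection j) := by
  obtain ⟨l, h1, h2, h3⟩ := exists_word_of_length J
    (mul_mem_parabolic hw (simpleReflection_mem_parabolic hj))
  obtain ⟨l', g1, g2, g3⟩ := exists_exchange hm (j := j) l (by
    rw [h2, Module.End.mul_apply, simpleReflection_simpleRoot hm, map_neg, neg_dotProduct]
    omega)
  have hwl : weylWord l' = w := by
    have := congrArg (· * simpleReflection j) (g3.symm.trans h2)
    simpa only [mul_assoc, simpleReflection_mul_self hm, mul_one] using this
  have := parabolicLength_le J l' fun i hi => h1 i (g1 i hi)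
  rw [hwl] at this
  omega

/-- If a shortest word for w ended in j, then w s_j would be shorter, whereas positivity of w α_j
makes it longer. -/
theorem eq_one_of_pos (hm : 2 ≤ m) {J : Finset (Fin m)} {w : Module.End ℤ (Fin m → ℤ)}
    (hw : w ∈ parabolic J) (hpos : ∀ j ∈ J, 0 < w (simpleRoot j) ⬝ᵥ rho) : w = 1 := by
  obtain ⟨l, h1, h2, h3⟩ := exists_word_of_length J hw
  rcases List.eq_nil_or_concat l with rfl | ⟨l', j, rfl⟩
  · rw [← h2]; simp [weylWord]
  · exfalso
    have hj : j ∈ J := h1 j (by simp)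
    have hlt := parabolicLength_lt hm hw hj (hpos j hj)
    have : w * simpleReflection j = weylWord l' := by
      rw [← h2, List.concat_eq_append, weylWord_append, weylWord_singleton, mul_assoc,
        simpleReflection_mul_self hm, mul_one]
    rw [this] at hlt
    have := parabolicLength_le J l' fun i hi => h1 i (by simp [hi])
    simp at h3
    omega

/-- Otherwise w_{0,J} s_j would be longer than w_{0,J}. -/
theorem longestElement_neg (hm : 2 ≤ m) {J : Finset (Fin m)} {j : Fin m} (hj : j ∈ J) :
    longestElement J (simpleRoot j) ⬝ᵥ rho < 0 := by
  obtain ⟨h1, h2⟩ := isLongest_longestElement hm J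
  have hne : longestElement J (simpleRoot j) ⬝ᵥ rho ≠ 0 := dotProduct_rho_ne_zero (by
    rw [parabolic_dotProduct hm h1, simpleRoot_dotProduct_self hm])
  by_contra hcon
  have h3 := parabolicLength_lt hm h1 hj (by omega)
  have h4 := h2 _ (mul_mem_parabolic h1 (simpleReflection_mem_parabolic hj))
  omega

theorem longestElement_mem (hm : 2 ≤ m) (J : Finset (Fin m)) : longestElement J ∈ parabolic J :=
  (isLongest_longestElement hm J).1

/-- Recognition of the longest element by an involution that sends simple roots to negatives of
simple roots. -/
theorem longestElement_eq (hm : 2 ≤ m) {J : Finset (Fin m)} {w : Module.End ℤ (Fin m → ℤ)}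
    (hw : w ∈ parabolic J) (hinv : w * w = 1)
    (h : ∀ j ∈ J, ∃ k ∈ J, w (simpleRoot j) = -simpleRoot k) : longestElement J = w := by
  -- Both factors reverse signs of the simple roots of J, so the product sends each of them to a
  -- positive root.
  have h1 : longestElement J * w = 1 := by
    apply eq_one_of_pos hm (mul_mem_parabolic (longestElement_mem hm J) hw)
    intro j hj
    obtain ⟨k, hk, hjk⟩ := h j hj
    have := longestElement_neg hm hk
    rw [Module.End.mul_apply, hjk, map_neg, neg_dotProduct]
    omega
  have := congrArg (· * w) h1
  simpa only [mul_assoc, hinv, mul_one, one_mul] using this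

theorem simpleRoot_injective : Function.Injective (simpleRoot (m := m)) := by
  intro i j h
  by_contra hne
  have h1 := congrFun h i
  have h2 := congrFun h j
  have h3 : ¬ i.1 = j.1 := fun h => hne (Fin.ext h)
  simp only [simpleRoot, Fin.ext_iff, if_true] at h1 h2
  split_ifs at h1 h2 <;> omega

theorem theta_eq {J : Finset (Fin m)} {j k : Fin m} (hj : j ∈ J) (hk : k ∈ J)
    (h : longestElement J (simpleRoot j) = -simpleRoot k) : theta J j = k := by
  have hex : j ∈ J ∧ ∃ k ∈ J, simpleRoot k = -(longestElement J (simpleRoot j)) :=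
    ⟨hj, k, hk, by rw [h, neg_neg]⟩
  unfold theta
  rw [dif_pos hex]
  apply simpleRoot_injective
  rw [hex.2.choose_spec.2, h, neg_neg]

end Weyl

/-! ### Explicit longest elements -/

section Longest

variable {m : ℕ}

/-- The permutation that reverses the interval `[a, b]`. -/
def rev (a b : ℕ) (hb : b < m) : Equiv.Perm (Fin m) :=
  Function.Involutive.toPerm
    (fun k => if h : a ≤ k.1 ∧ k.1 ≤ b then ⟨a + b - k.1, by omega⟩ else k) (by
      intro k
      by_cases h : a ≤ k.1 ∧ k.1 ≤ b
      · have h' : a ≤ a + b - k.1 ∧ a + b - k.1 ≤ b := by omega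
        simp only [dif_pos h, dif_pos h', Fin.ext_iff]
        omega
      · simp only [dif_neg h])

theorem rev_val (a b : ℕ) (hb : b < m) (k : Fin m) :
    (rev a b hb k).1 = if a ≤ k.1 ∧ k.1 ≤ b then a + b - k.1 else k.1 := by
  change (if h : a ≤ k.1 ∧ k.1 ≤ b then (⟨a + b - k.1, by omega⟩ : Fin m) else k).1 = _
  split_ifs <;> rfl

theorem rev_mul_self (a b : ℕ) (hb : b < m) : rev a b hb * rev a b hb = 1 := by
  ext k
  rw [Equiv.Perm.mul_apply, rev_val, rev_val, Equiv.Perm.one_apply]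
  split_ifs <;> omega

theorem swap_val (a b k : Fin m) :
    (Equiv.swap a b k).1 = if k.1 = a.1 then b.1 else if k.1 = b.1 then a.1 else k.1 := by
  rw [Equiv.swap_apply_def]
  simp only [Fin.ext_iff]
  split_ifs <;> rfl

/-- Induction through (a b+1) = (b b+1)(a b)(b b+1). -/
theorem swap_mem_of_adjacent (S : Submonoid (Equiv.Perm (Fin m))) (a : ℕ) :
    ∀ (b : ℕ) (hb : b < m) (hab : a < b)
    (_ : ∀ (k : ℕ) (hk : k + 1 < m), a ≤ k → k + 1 ≤ b →
      Equiv.swap (⟨k, by omega⟩ : Fin m) ⟨k + 1, hk⟩ ∈ S),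
    Equiv.swap (⟨a, by omega⟩ : Fin m) ⟨b, hb⟩ ∈ S := by
  intro b
  induction b with
  | zero => intro _ h; omega
  | succ b ih =>
    intro hb hab h
    rcases Nat.lt_succ_iff_lt_or_eq.1 hab with hlt | rfl
    · have h1 := ih (by omega) hlt fun k hk h1 h2 => h k hk h1 (by omega)
      have h2 := h b hb (by omega) le_rfl
      have h3 := Equiv.swap_mul_swap_mul_swap (x := (⟨a, by omega⟩ : Fin m))
        (y := ⟨b, by omega⟩) (z := ⟨b + 1, hb⟩) (by simp [Fin.ext_iff]; omega)
        (by simp [Fin.ext_iff]; omega)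
      rw [Equiv.swap_comm, ← h3]
      exact S.mul_mem (S.mul_mem h2 h1) h2
    · exact h a hb le_rfl le_rfl

theorem rev_mem_of_adjacent (S : Submonoid (Equiv.Perm (Fin m))) (t : ℕ) :
    ∀ (a b : ℕ) (hb : b < m) (_ : b ≤ a + t)
    (_ : ∀ (k : ℕ) (hk : k + 1 < m), a ≤ k → k + 1 ≤ b →
      Equiv.swap (⟨k, by omega⟩ : Fin m) ⟨k + 1, hk⟩ ∈ S),
    rev a b hb ∈ S := by
  induction t using Nat.strong_induction_on with
  | _ t ih =>
    intro a b hb hab h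
    by_cases hlt : a < b
    · have h1 := swap_mem_of_adjacent S a b hb hlt h
      have h2 := ih (t - 1) (by omega) (a + 1) (b - 1) (by omega) (by omega)
        fun k hk h1 h2 => h k hk (by omega) (by omega)
      -- Reverse the interior of the interval, then exchange the two ends.
      have : rev a b hb = Equiv.swap (⟨a, by omega⟩ : Fin m) ⟨b, hb⟩ *
          rev (a + 1) (b - 1) (by omega) := by
        ext k
        rw [Equiv.Perm.mul_apply, swap_val, rev_val, rev_val]
        simp only
        split_ifs <;> omega
      rw [this]
      exact S.mul_mem h1 h2
    · have : rev a b hb = 1 := by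
        ext k
        rw [rev_val, Equiv.Perm.one_apply]
        split_ifs <;> omega
      rw [this]
      exact S.one_mem

/-- The permutation action on `ℤ^m`. -/
def permEnd (π : Equiv.Perm (Fin m)) : Module.End ℤ (Fin m → ℤ) := LinearMap.funLeft ℤ ℤ π.symm

theorem permEnd_apply (π : Equiv.Perm (Fin m)) (z : Fin m → ℤ) (k : Fin m) :
    permEnd π z k = z (π.symm k) := rfl

theorem permEnd_mul (π π' : Equiv.Perm (Fin m)) : permEnd (π * π') = permEnd π * permEnd π' := rfl

theorem permEnd_one : permEnd (1 : Equiv.Perm (Fin m)) = 1 := rfl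

theorem simpleReflection_eq_permEnd (i : Fin m) (hi : i.1 + 1 < m) :
    simpleReflection i = permEnd (Equiv.swap i ⟨i.1 + 1, hi⟩) := by
  refine LinearMap.ext fun z => ?_
  ext k
  rw [simpleReflection_apply, simpleRoot_dotProduct (by omega), permEnd_apply, Equiv.symm_swap]
  simp only [nodeCol, nodeSnd, hi, if_true, dif_pos, Pi.sub_apply, Pi.smul_apply, smul_eq_mul,
    simpleRoot, Equiv.swap_apply_def]
  by_cases h1 : k = i
  · simp [h1]
  · by_cases h2 : k.1 = i.1 + 1
    · obtain rfl : k = ⟨i.1 + 1, hi⟩ := Fin.ext h2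
      simp [Fin.ext_iff]
    · simp [h1, h2, Fin.ext_iff]

/-- The diagram automorphism that exchanges the spin nodes, on weights. -/
def spinFlip : Module.End ℤ (Fin m → ℤ) where
  toFun z k := if k.1 + 1 = m then - z k else z k
  map_add' z z' := by ext k; simp only [Pi.add_apply]; split_ifs <;> ring
  map_smul' c z := by
    ext k
    simp only [Pi.smul_apply, smul_eq_mul, RingHom.id_apply]
    split_ifs <;> ring

theorem spinFlip_apply (z : Fin m → ℤ) (k : Fin m) :
    spinFlip z k = if k.1 + 1 = m then - z k else z k := rfl

/-- The diagram automorphism that exchanges the spin nodes, on nodes. -/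
def spinSwap (j : Fin m) : Fin m :=
  if j.1 + 1 = m then ⟨j.1 - 1, by omega⟩ else if h : j.1 + 2 = m then ⟨j.1 + 1, by omega⟩ else j

theorem spinSwap_val (j : Fin m) : (spinSwap j).1 =
    if j.1 + 1 = m then j.1 - 1 else if j.1 + 2 = m then j.1 + 1 else j.1 := by
  unfold spinSwap; split_ifs <;> rfl

theorem spinSwap_spinSwap (hm : 2 ≤ m) (j : Fin m) : spinSwap (spinSwap j) = j := by
  apply Fin.ext
  rw [spinSwap_val, spinSwap_val]
  split_ifs <;> omega

theorem spinFlip_mul_self : spinFlip * spinFlip = (1 : Module.End ℤ (Fin m → ℤ)) := by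
  refine LinearMap.ext fun z => ?_
  ext k
  rw [Module.End.mul_apply, spinFlip_apply, spinFlip_apply, Module.End.one_apply]
  split_ifs <;> simp

theorem spinFlip_spinFlip (z : Fin m → ℤ) : spinFlip (spinFlip z) = z :=
  LinearMap.congr_fun spinFlip_mul_self z

theorem spinFlip_dotProduct (z z' : Fin m → ℤ) : spinFlip z ⬝ᵥ spinFlip z' = z ⬝ᵥ z' := by
  unfold dotProduct
  refine Finset.sum_congr rfl fun k _ => ?_
  rw [spinFlip_apply, spinFlip_apply]
  split_ifs <;> ring

theorem nodeCol_val (j : Fin m) : (nodeCol j).1 = if j.1 + 1 < m then j.1 else j.1 - 1 := by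
  unfold nodeCol; split_ifs <;> rfl

theorem nodeCol_spinSwap (hm : 2 ≤ m) (j : Fin m) : nodeCol (spinSwap j) = nodeCol j := by
  apply Fin.ext
  rw [nodeCol_val, nodeCol_val, spinSwap_val]
  split_ifs <;> omega

theorem spinFlip_nodeCol (hm : 2 ≤ m) (j : Fin m) (z : Fin m → ℤ) :
    spinFlip z (nodeCol j) = z (nodeCol j) := by
  rw [spinFlip_apply, nodeCol_val, if_neg]
  split_ifs <;> omega

theorem nodeSnd_spinSwap (hm : 2 ≤ m) (j : Fin m) (z : Fin m → ℤ) :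
    nodeSnd (spinSwap j) z = nodeSnd j (spinFlip z) := by
  unfold nodeSnd
  simp only [spinFlip_apply]
  by_cases h1 : j.1 + 1 = m
  · have hv : (spinSwap j).1 + 1 = j.1 := by rw [spinSwap_val]; split_ifs; omega
    have h2 : ¬ j.1 + 1 < m := by omega
    have h3 : (spinSwap j).1 + 1 < m := by omega
    rw [dif_pos h3, dif_neg h2, if_pos h1, neg_neg]
    congr 1
    exact Fin.ext hv
  · by_cases h2 : j.1 + 2 = m
    · have hv : (spinSwap j).1 = j.1 + 1 := by rw [spinSwap_val]; split_ifs; omega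
      have h3 : ¬ (spinSwap j).1 + 1 < m := by omega
      have h4 : j.1 + 1 < m := by omega
      rw [dif_pos h4, dif_neg h3, if_pos (by omega)]
      congr 2
      exact Fin.ext hv
    · have hv : spinSwap j = j := by apply Fin.ext; rw [spinSwap_val]; split_ifs; omega
      have h4 : j.1 + 1 < m := by omega
      rw [hv, dif_pos h4, dif_pos h4, if_neg (by omega)]

theorem spinFlip_simpleRoot (hm : 2 ≤ m) (j : Fin m) :
    spinFlip (simpleRoot j) = simpleRoot (spinSwap j) := by
  apply dotProduct_eq
  intro z
  rw [simpleRoot_dotProduct hm, ← spinFlip_dotProduct, spinFlip_spinFlip, simpleRoot_dotProduct hm,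
    nodeCol_spinSwap hm, nodeSnd_spinSwap hm, spinFlip_nodeCol hm]

theorem spinFlip_conj_mem_parabolic (hm : 2 ≤ m) {J : Finset (Fin m)}
    {w : Module.End ℤ (Fin m → ℤ)} (hw : w ∈ parabolic J) :
    spinFlip * w * spinFlip ∈ parabolic (J.image spinSwap) := by
  obtain ⟨l, hl, rfl⟩ := hw
  refine ⟨l.map spinSwap, ?_, ?_⟩
  · intro i hi
    obtain ⟨j, hj, rfl⟩ := List.mem_map.1 hi
    exact Finset.mem_image_of_mem _ (hl j hj)
  · clear hl
    induction l with
    | nil => simp [weylWord, spinFlip_mul_self]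
    | cons i l ih =>
      rw [List.map_cons, weylWord_cons, weylWord_cons, ih, ← mul_assoc, ← mul_assoc,
        ← mul_assoc, ← mul_simpleReflection_of_dotProduct spinFlip_dotProduct
          (Or.inl (spinFlip_simpleRoot hm i))]

/-- The simple reflections before the last one permute coordinates, and the last one is conjugate to
such a permutation by a sign change. With the defects permuted, this keeps the length n of a row
fixed. -/
theorem sum_abs_parabolic {J : Finset (Fin m)} (hm : 2 ≤ m)
    {w : Module.End ℤ (Fin m → ℤ)} (hw : w ∈ parabolic J) (z : Fin m → ℤ) :
    ∑ k, |w z k| = ∑ k, |z k| := by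
  have hflip : ∀ z : Fin m → ℤ, ∑ k, |spinFlip z k| = ∑ k, |z k| := by
    intro z
    refine Finset.sum_congr rfl fun k _ => ?_
    rw [spinFlip_apply]; split_ifs <;> simp
  have hlt : ∀ i : Fin m, i.1 + 1 < m → ∀ z, ∑ k, |simpleReflection i z k| = ∑ k, |z k| := by
    intro i hi z
    rw [simpleReflection_eq_permEnd i hi]
    exact Equiv.sum_comp (Equiv.swap i ⟨i.1 + 1, hi⟩).symm fun k => |z k|
  have hrefl : ∀ i z, ∑ k, |simpleReflection (m := m) i z k| = ∑ k, |z k| := by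
    intro i z
    by_cases hi : i.1 + 1 < m
    · exact hlt i hi z
    · have h1 := mul_simpleReflection_of_dotProduct spinFlip_dotProduct
          (Or.inl (spinFlip_simpleRoot hm i))
      have h2 : simpleReflection i z =
          spinFlip (simpleReflection (spinSwap i) (spinFlip z)) := by
        rw [← Module.End.mul_apply (simpleReflection (spinSwap i)), ← h1, Module.End.mul_apply,
          spinFlip_spinFlip]
      rw [h2, hflip, hlt, hflip]
      rw [spinSwap_val]; split_ifs <;> omega
  obtain ⟨l, -, rfl⟩ := hw
  induction l with
  | nil => simp [weylWord]
  | cons i l ih => rw [weylWord_cons, Module.End.mul_apply, hrefl, ih]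

/-- The permutations of the columns generated by the transpositions `(k, k + 1)` that fix the last
column. -/
def columnPerm (m : ℕ) : Subgroup (Equiv.Perm (Fin m)) :=
  Subgroup.closure {π | ∃ (k : ℕ) (hk : k + 2 < m),
    Equiv.swap (⟨k, by omega⟩ : Fin m) ⟨k + 1, by omega⟩ = π}

theorem columnPerm_apply_last {π : Equiv.Perm (Fin m)} (hπ : π ∈ columnPerm m) (k : Fin m)
    (hk : k.1 + 1 = m) : π k = k := by
  have : columnPerm m ≤ MulAction.stabilizer (Equiv.Perm (Fin m)) k := by
    rw [columnPerm, Subgroup.closure_le]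
    rintro _ ⟨l, hl, rfl⟩
    apply Fin.ext
    change (Equiv.swap _ _ k).1 = _
    rw [swap_val]
    simp only
    split_ifs <;> omega
  exact this hπ

/-- `w` acts on weights and `π` on defects as the Schützenberger involution for `J`, with node
involution `θ`. -/
structure CactusDatum (J : Finset (Fin m)) (w : Module.End ℤ (Fin m → ℤ))
    (π : Equiv.Perm (Fin m)) (θ : Fin m → Fin m) : Prop where
  w_mem : w ∈ parabolic J
  w_sq : w * w = 1
  θ_mem : ∀ j ∈ J, θ j ∈ J
  π_sq : π * π = 1
  π_col : ∀ j ∈ J, π (nodeCol j) = nodeCol (θ j)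
  π_fix : ∀ k, (∀ j ∈ J, nodeCol j ≠ k) → π k = k
  π_mem : π ∈ columnPerm m
  w_node : ∀ j ∈ J, ∀ z,
    (w z (nodeCol j) = nodeSnd (θ j) z ∧ nodeSnd j (w z) = z (nodeCol (θ j))) ∨
    (w z (nodeCol j) = -z (nodeCol (θ j)) ∧ nodeSnd j (w z) = -nodeSnd (θ j) z)

namespace CactusDatum

variable {J : Finset (Fin m)} {w : Module.End ℤ (Fin m → ℤ)} {π : Equiv.Perm (Fin m)}
  {θ : Fin m → Fin m}

/-- An isometric involution is self-adjoint, so it is enough to compare ⟨α_j, w z⟩ with -⟨α_{θ j},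
z⟩, which `w_node` evaluates. -/
theorem w_simpleRoot (hm : 2 ≤ m) (h : CactusDatum J w π θ) {j : Fin m} (hj : j ∈ J) :
    w (simpleRoot j) = -simpleRoot (θ j) := by
  apply dotProduct_eq
  intro z
  have hz : w (w z) = z := LinearMap.congr_fun h.w_sq z
  rw [← hz, parabolic_dotProduct hm h.w_mem, hz, neg_dotProduct, simpleRoot_dotProduct hm,
    simpleRoot_dotProduct hm]
  rcases h.w_node j hj z with ⟨h1, h2⟩ | ⟨h1, h2⟩ <;> rw [h1, h2] <;> ring

theorem longestElement_eq (hm : 2 ≤ m) (h : CactusDatum J w π θ) : longestElement J = w :=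
  _root_.longestElement_eq hm h.w_mem h.w_sq
    fun j hj => ⟨θ j, h.θ_mem j hj, h.w_simpleRoot hm hj⟩

theorem theta_eq (hm : 2 ≤ m) (h : CactusDatum J w π θ) {j : Fin m} (hj : j ∈ J) :
    theta J j = θ j :=
  _root_.theta_eq hj (h.θ_mem j hj) (by rw [h.longestElement_eq hm]; exact h.w_simpleRoot hm hj)

/-- Serves the diagrams that contain the last node but not the other spin node. The permutation π is
unchanged because the two spin nodes share a column. -/
theorem conj (hm : 2 ≤ m) (h : CactusDatum J w π θ) :
    CactusDatum (J.image spinSwap) (spinFlip * w * spinFlip) π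
      (fun j => spinSwap (θ (spinSwap j))) where
  w_mem := spinFlip_conj_mem_parabolic hm h.w_mem
  w_sq := by
    calc spinFlip * w * spinFlip * (spinFlip * w * spinFlip)
        = spinFlip * w * (spinFlip * spinFlip) * w * spinFlip := by simp only [mul_assoc]
      _ = spinFlip * (w * w) * spinFlip := by rw [spinFlip_mul_self]; simp only [mul_assoc, mul_one]
      _ = 1 := by rw [h.w_sq, mul_one, spinFlip_mul_self]
  θ_mem := by
    intro j hj
    obtain ⟨i, hi, rfl⟩ := Finset.mem_image.1 hj
    rw [spinSwap_spinSwap hm]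
    exact Finset.mem_image_of_mem _ (h.θ_mem i hi)
  π_sq := h.π_sq
  π_col := by
    intro j hj
    obtain ⟨i, hi, rfl⟩ := Finset.mem_image.1 hj
    rw [spinSwap_spinSwap hm, nodeCol_spinSwap hm, nodeCol_spinSwap hm, h.π_col i hi]
  π_fix := by
    intro k hk
    refine h.π_fix k fun j hj => ?_
    rw [← nodeCol_spinSwap hm]
    exact hk _ (Finset.mem_image_of_mem _ hj)
  π_mem := h.π_mem
  w_node := by
    intro j hj z
    obtain ⟨i, hi, rfl⟩ := Finset.mem_image.1 hj
    simp only [Module.End.mul_apply]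
    rw [spinSwap_spinSwap hm, nodeCol_spinSwap hm, nodeCol_spinSwap hm, nodeSnd_spinSwap hm,
      nodeSnd_spinSwap hm, spinFlip_nodeCol hm, spinFlip_spinFlip, ← spinFlip_nodeCol hm (θ i) z]
    exact h.w_node i hi (spinFlip z)

end CactusDatum

/-- The nodes `a, …, b`. -/
def nodeIcc (m a b : ℕ) : Finset (Fin m) := Finset.univ.filter fun k => a ≤ k.1 ∧ k.1 ≤ b

theorem mem_nodeIcc {a b : ℕ} {k : Fin m} : k ∈ nodeIcc m a b ↔ a ≤ k.1 ∧ k.1 ≤ b := by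
  simp [nodeIcc]

/-- In type A the parabolic subgroup permutes the coordinates a, …, b + 1 and its longest element
reverses them. The nodes a, …, b are their own columns, so π is the same reversal as θ, on one
column fewer than w reverses. -/
theorem cactusDatum_Icc {a b : ℕ} (hb : b + 1 < m) :
    CactusDatum (nodeIcc m a b) (permEnd (rev a (b + 1) hb)) (rev a b (by omega))
      (rev a b (by omega)) := by
  have hcol : ∀ j ∈ nodeIcc m a b, nodeCol j = j := by
    intro j hj
    rw [mem_nodeIcc] at hj
    exact if_pos (by omega)
  have hθ : ∀ j ∈ nodeIcc m a b, rev a b (by omega) j ∈ nodeIcc m a b := by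
    intro j hj
    rw [mem_nodeIcc] at hj ⊢
    rw [rev_val, if_pos hj]
    omega
  refine ⟨?_, ?_, hθ, rev_mul_self _ _ _, ?_, ?_, ?_, ?_⟩
  · let S : Submonoid (Equiv.Perm (Fin m)) :=
      { carrier := {π | permEnd π ∈ parabolic (nodeIcc m a b)}
        one_mem' := one_mem_parabolic _
        mul_mem' := fun h h' => mul_mem_parabolic h h' }
    refine rev_mem_of_adjacent S (b + 1) a (b + 1) hb (by omega) fun k hk h1 h2 => ?_
    change permEnd _ ∈ parabolic _
    rw [← simpleReflection_eq_permEnd ⟨k, by omega⟩ hk]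
    exact simpleReflection_mem_parabolic (mem_nodeIcc.2 ⟨h1, by simp only; omega⟩)
  · rw [← permEnd_mul, rev_mul_self, permEnd_one]
  · intro j hj
    rw [hcol j hj, hcol _ (hθ j hj)]
  · intro k hk
    apply Fin.ext
    rw [rev_val, if_neg]
    intro h
    exact hk k (mem_nodeIcc.2 h) (hcol k (mem_nodeIcc.2 h))
  · exact rev_mem_of_adjacent (columnPerm m).toSubmonoid b a b (by omega) (by omega)
      fun k hk h1 h2 => Subgroup.subset_closure ⟨k, by omega, rfl⟩
  · intro j hj z
    left
    have hsymm : ∀ k, (rev a (b + 1) hb).symm k = rev a (b + 1) hb k := fun _ => rfl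
    have hj' := hθ j hj
    rw [hcol j hj, hcol _ hj', permEnd_apply, hsymm]
    rw [mem_nodeIcc] at hj hj'
    have hv : (rev a b (by omega : b < m) j).1 = a + b - j.1 := by rw [rev_val, if_pos hj]
    unfold nodeSnd
    rw [dif_pos (by omega), dif_pos (by omega), permEnd_apply, hsymm]
    constructor <;> congr 1 <;> apply Fin.ext <;>
      rw [rev_val, if_pos (by first | omega | (simp only; omega))] <;>
      simp only [hv] <;> omega

/-- Negation of the coordinates `a, …, m - 1`, up to a sign on the last one. -/
def negEnd (a : ℕ) : Module.End ℤ (Fin m → ℤ) where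
  toFun z k := if k.1 < a then z k else if k.1 + 1 = m ∧ (m - a) % 2 = 1 then z k else - z k
  map_add' z z' := by ext k; simp only [Pi.add_apply]; split_ifs <;> ring
  map_smul' c z := by
    ext k
    simp only [Pi.smul_apply, smul_eq_mul, RingHom.id_apply]
    split_ifs <;> ring

theorem negEnd_apply (a : ℕ) (z : Fin m → ℤ) (k : Fin m) : negEnd a z k =
    if k.1 < a then z k else if k.1 + 1 = m ∧ (m - a) % 2 = 1 then z k else - z k := rfl

/-- Negation of the coordinate `p` and of the last one. -/
def negPair (p : ℕ) : Module.End ℤ (Fin m → ℤ) where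
  toFun z k := if k.1 = p ∨ k.1 + 1 = m then - z k else z k
  map_add' z z' := by ext k; simp only [Pi.add_apply]; split_ifs <;> ring
  map_smul' c z := by
    ext k
    simp only [Pi.smul_apply, smul_eq_mul, RingHom.id_apply]
    split_ifs <;> ring

theorem negPair_apply (p : ℕ) (z : Fin m → ℤ) (k : Fin m) : negPair p z k =
    if k.1 = p ∨ k.1 + 1 = m then - z k else z k := rfl

/-- For the spin pair this is the product of the two orthogonal reflections s_{m-1} s_m (labels from
1); conjugation by s_p moves the first sign change from p + 1 down to p. -/
theorem negPair_mem_parabolic (t : ℕ) : ∀ p, p + t + 2 = m →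
    negPair p ∈ parabolic (nodeIcc m p m) := by
  induction t with
  | zero =>
    intro p hp
    have hm : 2 ≤ m := by omega
    set i : Fin m := ⟨p, by omega⟩ with hi
    set j : Fin m := ⟨p + 1, by omega⟩ with hj
    have hij : spinSwap i = j := by
      apply Fin.ext
      rw [spinSwap_val]
      simp only [hi, hj]
      split_ifs <;> omega
    have h1 := mul_simpleReflection_of_dotProduct spinFlip_dotProduct
          (Or.inl (spinFlip_simpleRoot hm i))
    rw [hij] at h1
    have h2 : negPair p = simpleReflection i * simpleReflection j := by
      have h3 : simpleReflection j = spinFlip * simpleReflection i * spinFlip := by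
        rw [h1, mul_assoc, spinFlip_mul_self, mul_one]
      rw [h3, simpleReflection_eq_permEnd i (by simp only [hi]; omega)]
      refine LinearMap.ext fun z => ?_
      ext k
      simp only [Module.End.mul_apply, permEnd_apply, spinFlip_apply, negPair_apply,
        Equiv.symm_swap, Equiv.swap_apply_self, swap_val, hi]
      split_ifs <;> first | rfl | omega
    rw [h2]
    exact mul_mem_parabolic
      (simpleReflection_mem_parabolic (mem_nodeIcc.2 ⟨by simp [hi], by simp only [hi]; omega⟩))
      (simpleReflection_mem_parabolic (mem_nodeIcc.2 ⟨by simp [hj], by simp only [hj]; omega⟩))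
  | succ t ih =>
    intro p hp
    have h1 := ih (p + 1) (by omega)
    set i : Fin m := ⟨p, by omega⟩ with hi
    have hmem : simpleReflection i ∈ parabolic (nodeIcc m p m) :=
      simpleReflection_mem_parabolic (mem_nodeIcc.2 ⟨by simp [hi], by simp only [hi]; omega⟩)
    have h3 : negPair p = simpleReflection i * negPair (p + 1) * simpleReflection i := by
      rw [simpleReflection_eq_permEnd i (by simp only [hi]; omega)]
      refine LinearMap.ext fun z => ?_
      ext k
      simp only [Module.End.mul_apply, permEnd_apply, negPair_apply,
        Equiv.symm_swap, Equiv.swap_apply_self, swap_val, hi]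
      split_ifs <;> first | rfl | omega
    rw [h3]
    refine mul_mem_parabolic (mul_mem_parabolic hmem (parabolic_mono ?_ h1)) hmem
    intro k hk
    rw [mem_nodeIcc] at hk ⊢
    omega

/-- The coordinates are negated one at a time, each together with the last one, whose sign thus
records a parity. With a single coordinate left nothing is negated. -/
theorem negEnd_mem_parabolic (t : ℕ) : ∀ a, a + t + 1 = m →
    negEnd a ∈ parabolic (nodeIcc m a m) := by
  induction t with
  | zero =>
    intro a ha
    have : negEnd a = (1 : Module.End ℤ (Fin m → ℤ)) := by
      refine LinearMap.ext fun z => ?_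
      ext k
      rw [negEnd_apply, Module.End.one_apply]
      split_ifs <;> first | rfl | omega
    rw [this]
    exact one_mem_parabolic _
  | succ t ih =>
    intro a ha
    have h1 := ih (a + 1) (by omega)
    have h2 := negPair_mem_parabolic (m := m) t a (by omega)
    have h3 : negEnd a = negPair a * negEnd (a + 1) (m := m) := by
      refine LinearMap.ext fun z => ?_
      ext k
      simp only [Module.End.mul_apply, negEnd_apply, negPair_apply]
      split_ifs <;> first | rfl | omega
    rw [h3]
    refine mul_mem_parabolic h2 (parabolic_mono ?_ h1)
    intro k hk
    rw [mem_nodeIcc] at hk ⊢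
    omega

/-- The longest element in type D is -1, corrected by a sign on the last coordinate in odd rank, so
θ is trivial or exchanges the spin nodes. These have the same column, whence π = 1. The upper bound
m in `nodeIcc m a m` imposes nothing. -/
theorem cactusDatum_spin {a : ℕ} (ha : a + 2 ≤ m) :
    CactusDatum (nodeIcc m a m) (negEnd a) 1
      (fun j => if (m - a) % 2 = 1 then spinSwap j else j) := by
  refine ⟨negEnd_mem_parabolic (m - a - 1) a (by omega), ?_, ?_, one_mul 1, ?_, fun _ _ => rfl,
    one_mem _, ?_⟩
  · refine LinearMap.ext fun z => ?_
    ext k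
    simp only [Module.End.mul_apply, negEnd_apply, Module.End.one_apply]
    split_ifs <;> simp
  · intro j hj
    rw [mem_nodeIcc] at hj ⊢
    split_ifs
    · rw [spinSwap_val]; split_ifs <;> omega
    · exact hj
  · intro j hj
    split_ifs
    · rw [nodeCol_spinSwap (by omega), Equiv.Perm.one_apply]
    · rfl
  · intro j hj z
    right
    rw [mem_nodeIcc] at hj
    have hc : nodeCol (if (m - a) % 2 = 1 then spinSwap j else j) = nodeCol j := by
      split_ifs
      · exact nodeCol_spinSwap (by omega) j
      · rfl
    have hv := nodeCol_val j
    simp only [hc]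
    refine ⟨?_, ?_⟩
    · rw [negEnd_apply, if_neg, if_neg] <;> split_ifs at hv <;> omega
    · split_ifs with hp
      · rw [nodeSnd_spinSwap (by omega)]
        unfold nodeSnd
        split_ifs with h1
        · rw [negEnd_apply, spinFlip_apply]
          split_ifs <;> simp only [neg_neg] at * <;> omega
        · rw [negEnd_apply, spinFlip_apply]
          split_ifs <;> first | rfl | omega
      · unfold nodeSnd
        split_ifs with h1
        · rw [negEnd_apply]
          split_ifs <;> simp only at * <;> omega
        · rw [negEnd_apply]
          split_ifs <;> first | rfl | omega

end Longest

/-! ### Connected subdiagrams -/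

section Diagram

variable {m : ℕ}

theorem dynkin_adj_iff_of_lt {i j : Fin m} (hij : i.1 < j.1) :
    (dynkin m).Adj i j ↔ (j.1 = i.1 + 1 ∧ j.1 + 1 < m) ∨ (i.1 + 3 = m ∧ j.1 + 1 = m) := by
  have hj := j.2
  have hi : i.1 + 1 < m := by omega
  have hne : i ≠ j := fun h => by rw [h] at hij; omega
  change (i ≠ j ∧ simpleRoot i ⬝ᵥ simpleRoot j ≠ 0) ↔ _
  rw [simpleRoot_dotProduct (by omega)]
  simp only [nodeCol, nodeSnd, hi, if_true, dif_pos, simpleRoot, Fin.ext_iff]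
  split_ifs <;> simp <;> omega

theorem connected_induction {J : Finset (Fin m)}
    (hJ : ((dynkin m).induce (J : Set (Fin m))).Connected) (P : Fin m → Prop)
    (hP : ∀ u ∈ J, ∀ v ∈ J, (dynkin m).Adj u v → P u → P v) {a c : Fin m} (ha : a ∈ J)
    (hc : c ∈ J) (h : P a) : P c := by
  obtain ⟨p⟩ := hJ.preconnected ⟨a, ha⟩ ⟨c, hc⟩
  have key : ∀ (u v : (J : Set (Fin m))), ((dynkin m).induce (J : Set (Fin m))).Walk u v →
      P u.1 → P v.1 := by
    intro u v p
    induction p with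
    | nil => exact id
    | @cons u v w h p ih => exact fun hu => ih (hP _ u.2 _ v.2 h hu)
  exact key _ _ p h

/-- An edge that jumps over a node joins the third last node to the last one and jumps over the
second last only. So removing any x with x + 2 < m separates the nodes below it from those above. -/
theorem mem_of_connected_of_between {J : Finset (Fin m)}
    (hJ : ((dynkin m).induce (J : Set (Fin m))).Connected) {a c x : Fin m} (ha : a ∈ J)
    (hc : c ∈ J) (hax : a.1 ≤ x.1) (hxc : x.1 ≤ c.1) (hx : x.1 + 2 < m) : x ∈ J := by
  by_contra hn
  have hne : ∀ u ∈ J, u.1 ≠ x.1 := fun u hu h => hn (Fin.ext h ▸ hu)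
  have h1 := hne a ha
  have h2 : c.1 < x.1 := by
    refine connected_induction hJ (fun u => u.1 < x.1) (fun u hu v hv huv hux => ?_) ha hc
      (by omega)
    have := hne v hv
    by_contra hvx
    rw [dynkin_adj_iff_of_lt (by omega)] at huv
    omega
  omega

theorem connected_classification (hm : 2 ≤ m) {J : Finset (Fin m)}
    (hJ : ((dynkin m).induce (J : Set (Fin m))).Connected) :
    (∃ a b, a ≤ b ∧ b + 1 < m ∧ J = nodeIcc m a b) ∨
    (∃ a, a + 2 ≤ m ∧ J = (nodeIcc m a (m - 2)).image spinSwap) ∨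
    (∃ a, a + 3 ≤ m ∧ J = nodeIcc m a m) := by
  have hne : J.Nonempty := by
    obtain ⟨x⟩ := hJ.nonempty
    exact ⟨x.1, x.2⟩
  obtain ⟨a, ha, hamin⟩ := J.exists_min_image (fun k => k.1) hne
  obtain ⟨b, hb, hbmax⟩ := J.exists_max_image (fun k => k.1) hne
  have hab := hamin b hb
  by_cases hbl : b.1 + 1 < m
  · left
    refine ⟨a, b, hab, hbl, ?_⟩
    ext x
    rw [mem_nodeIcc]
    refine ⟨fun hx => ⟨hamin x hx, hbmax x hx⟩, fun hx => ?_⟩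
    by_cases hxb : x = b
    · rw [hxb]; exact hb
    · have : x.1 ≠ b.1 := fun h => hxb (Fin.ext h)
      exact mem_of_connected_of_between hJ ha hb hx.1 hx.2 (by omega)
  · right
    set s : Fin m := ⟨m - 2, by omega⟩ with hs
    by_cases hsJ : s ∈ J
    · right
      have has : a.1 ≤ m - 2 := hamin s hsJ
      -- The spin nodes are not adjacent, so a connected J containing both has a further node below
      -- them.
      have hane : a.1 + 2 ≠ m := by
        intro h
        have : b = s := by
          refine connected_induction hJ (fun u => u = s) (fun u hu v hv huv hus => ?_) hsJ hb rfl
          have h1 := hamin v hv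
          have h2 := v.2
          apply Fin.ext
          by_contra hvs
          have hus' : u.1 = m - 2 := by rw [hus]
          simp only [hs] at hvs
          rw [dynkin_adj_iff_of_lt (by omega)] at huv
          omega
        rw [this] at hbl
        simp only [hs] at hbl
        omega
      refine ⟨a, by omega, ?_⟩
      ext x
      rw [mem_nodeIcc]
      refine ⟨fun hx => ⟨hamin x hx, x.2.le⟩, fun hx => ?_⟩
      by_cases hx1 : x.1 + 1 = m
      · rwa [show x = b from Fin.ext (by omega)]
      · by_cases hx2 : x.1 + 2 = m
        · rwa [show x = s from Fin.ext (by simp only [hs]; omega)]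
        · exact mem_of_connected_of_between hJ ha hb hx.1 (by omega) (by omega)
    · left
      -- If J consists of the last node alone, its preimage under `spinSwap` starts at the other
      -- spin node; otherwise the least node of J is unaffected.
      refine ⟨if a.1 + 1 = m then m - 2 else a.1, by split_ifs <;> omega, ?_⟩
      ext x
      have hsne : ∀ u ∈ J, u.1 ≠ m - 2 := fun u hu h => hsJ (by
        rwa [← show u = s from Fin.ext (by simp only [hs]; omega)])
      have ha2 := hsne a ha
      rw [Finset.mem_image]
      constructor
      · intro hx
        refine ⟨spinSwap x, ?_, spinSwap_spinSwap hm x⟩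
        have h1 := hamin x hx
        have h2 := hsne x hx
        rw [mem_nodeIcc, spinSwap_val]
        split_ifs <;> omega
      · rintro ⟨y, hy, rfl⟩
        rw [mem_nodeIcc] at hy
        by_cases hy2 : y.1 + 2 = m
        · rwa [show spinSwap y = b from Fin.ext (by rw [spinSwap_val]; split_ifs <;> omega)]
        · have hy3 : spinSwap y = y := by
            apply Fin.ext; rw [spinSwap_val]; split_ifs at * <;> omega
          rw [hy3]
          exact mem_of_connected_of_between hJ ha hb (by split_ifs at hy <;> omega)
            (by omega) (by omega)

end Diagram

/-! ### Components of restricted crystals -/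

section Components

variable {m n : ℕ}

theorem finite_rowTableau : Finite (RowTableau m n) := by
  have : Finite (Letter m) := by
    refine Finite.of_injective (β := Fin m ⊕ Fin m)
      (fun a => match a with | .pos k => Sum.inl k | .bar k => Sum.inr k) ?_
    intro a b h
    cases a <;> cases b <;> simp_all
  infer_instance

theorem sameComponent_wt (hm : 2 ≤ m) {J : Finset (Fin m)} {b b' : RowTableau m n}
    (h : (rowCrystal m n).SameComponent J b b') (v : Fin m → ℤ)
    (hv : ∀ j ∈ J, simpleRoot j ⬝ᵥ v = 0) :
    (rowCrystal m n).wt b ⬝ᵥ v = (rowCrystal m n).wt b' ⬝ᵥ v := by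
  induction h with
  | rel b b' h =>
    obtain ⟨j, hj, h⟩ := h
    rw [(row_f_imp hm h).1, sub_dotProduct, hv j hj, sub_zero]
  | refl => rfl
  | symm _ _ _ ih => exact ih.symm
  | trans _ _ _ _ _ ih ih' => exact ih.trans ih'

theorem sameComponent_wt_apply (hm : 2 ≤ m) {J : Finset (Fin m)} {b b' : RowTableau m n}
    (h : (rowCrystal m n).SameComponent J b b') (k : Fin m)
    (hk : ∀ j ∈ J, simpleRoot j k = 0) :
    (rowCrystal m n).wt b k = (rowCrystal m n).wt b' k := by
  simpa using sameComponent_wt hm h (Pi.single k 1) fun j hj => by simpa using hk j hj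

theorem sameComponent_defect (hm : 2 ≤ m) {J : Finset (Fin m)} {b b' : RowTableau m n}
    (h : (rowCrystal m n).SameComponent J b b') (k : Fin m) (hk : ∀ j ∈ J, nodeCol j ≠ k) :
    defect b k = defect b' k := by
  induction h with
  | rel b b' h =>
    obtain ⟨j, hj, h⟩ := h
    exact ((row_f_imp hm h).2.2 k (hk j hj).symm).symm
  | refl => rfl
  | symm _ _ _ ih => exact ih.symm
  | trans _ _ _ _ _ ih ih' => exact ih.trans ih'

/-- A component is finite and every e_j raises ⟨wt, ρ⟩ by one, so a maximum of this pairing is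
killed by all e_j with j in J. -/
theorem exists_highest (hm : 2 ≤ m) (J : Finset (Fin m)) (b : RowTableau m n) :
    ∃ h, (rowCrystal m n).SameComponent J b h ∧ ∀ j ∈ J, (rowCrystal m n).eps j h = 0 := by
  have := finite_rowTableau (m := m) (n := n)
  obtain ⟨h, hh, hmax⟩ := Set.exists_max_image {h | (rowCrystal m n).SameComponent J b h}
    (fun h => (rowCrystal m n).wt h ⬝ᵥ rho) (Set.toFinite _) ⟨b, Relation.EqvGen.refl b⟩
  refine ⟨h, hh, fun j hj => ?_⟩
  by_contra hne
  obtain ⟨h', hh'⟩ := Option.ne_none_iff_exists'.1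
    (fun hn => hne (((rowCrystal_seminormal hm n).1.e_none j h).1 hn))
  rw [row_e_iff hm] at hh'
  have h1 := hmax h' (hh.trans _ _ _
    (Relation.EqvGen.symm _ _ (Relation.EqvGen.rel _ _ ⟨j, hj, hh'⟩)))
  have h2 := (row_f_imp hm hh').1
  simp only [h2, sub_dotProduct, simpleRoot_dotProduct_rho hm] at h1
  omega

theorem highest_node (hm : 2 ≤ m) {j : Fin m} {b : RowTableau m n}
    (h : (rowCrystal m n).eps j b = 0) : defect b (nodeCol j) = 0 ∧
      0 ≤ (rowCrystal m n).wt b (nodeCol j) ∧ nodeSnd j ((rowCrystal m n).wt b) ≤ 0 := by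
  rw [(rowCrystal_string hm j b).1] at h
  omega

/-- Tableaux whose weights and defects correspond under `w` and `π` lie in the same component of
the crystal restricted to `J`. -/
def PreservesComponents (J : Finset (Fin m)) (w : Module.End ℤ (Fin m → ℤ))
    (π : Equiv.Perm (Fin m)) : Prop :=
  ∀ (n : ℕ) (b b' : RowTableau m n), (rowCrystal m n).wt b' = w ((rowCrystal m n).wt b) →
    (∀ k, defect b' k = defect b (π k)) → (rowCrystal m n).SameComponent J b b'

theorem sum_abs_eq_of_defect_eq {b b' : RowTableau m n} (h : ∀ k, defect b k = defect b' k) :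
    ∑ k, (|(rowCrystal m n).wt b k| - |(rowCrystal m n).wt b' k|) = 0 := by
  have h1 := sum_abs_wt_add_defect b
  have h2 := sum_abs_wt_add_defect b'
  simp only [h] at h1
  rw [Finset.sum_sub_distrib]
  omega

/-- Being highest forces defects 0 in columns a, …, b, z_k = 0 strictly between a and b + 1, and z_a
≥ 0 ≥ z_{b+1}. The coordinate sum fixes z_a + z_{b+1}; the length n together with the defects fixes
|z_a| + |z_{b+1}| = z_a - z_{b+1}. -/
theorem highest_Icc_unique {a b : ℕ} (hb : b + 1 < m) (hab : a ≤ b) {h h' : RowTableau m n}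
    (hh : ∀ j ∈ nodeIcc m a b, (rowCrystal m n).eps j h = 0)
    (hh' : ∀ j ∈ nodeIcc m a b, (rowCrystal m n).eps j h' = 0)
    (hd : ∀ k, k ∉ nodeIcc m a b → defect h k = defect h' k)
    (hz : ∀ k, k ∉ nodeIcc m a (b + 1) → (rowCrystal m n).wt h k = (rowCrystal m n).wt h' k)
    (hs : ∑ k, ((rowCrystal m n).wt h k - (rowCrystal m n).wt h' k) = 0) : h = h' := by
  have hm : 2 ≤ m := by omega
  have key : ∀ g : RowTableau m n, (∀ j ∈ nodeIcc m a b, (rowCrystal m n).eps j g = 0) →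
      ∀ k : Fin m, (a ≤ k.1 → k.1 ≤ b → defect g k = 0 ∧ 0 ≤ (rowCrystal m n).wt g k) ∧
        (a < k.1 → k.1 ≤ b + 1 → (rowCrystal m n).wt g k ≤ 0) := by
    intro g hg k
    constructor
    · intro h1 h2
      have h3 := highest_node hm (hg k (mem_nodeIcc.2 ⟨h1, h2⟩))
      rw [show nodeCol k = k from if_pos (by omega)] at h3
      exact ⟨h3.1, h3.2.1⟩
    · intro h1 h2
      have h3 := (highest_node hm (hg ⟨k.1 - 1, by omega⟩
        (mem_nodeIcc.2 ⟨by simp only; omega, by simp only; omega⟩))).2.2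
      unfold nodeSnd at h3
      rw [dif_pos (by simp only; omega)] at h3
      rwa [show (⟨k.1 - 1 + 1, by omega⟩ : Fin m) = k from Fin.ext (by simp only; omega)] at h3
  have kh := key h hh
  have kh' := key h' hh'
  have hd' : ∀ k, defect h k = defect h' k := by
    intro k
    by_cases hk : k ∈ nodeIcc m a b
    · rw [mem_nodeIcc] at hk
      rw [((kh k).1 hk.1 hk.2).1, ((kh' k).1 hk.1 hk.2).1]
    · exact hd k hk
  have hmid : ∀ k : Fin m, k.1 ≠ a → k.1 ≠ b + 1 →
      (rowCrystal m n).wt h k = (rowCrystal m n).wt h' k := by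
    intro k h1 h2
    by_cases hk : a ≤ k.1 ∧ k.1 ≤ b
    · have e1 := ((kh k).1 hk.1 hk.2).2
      have e2 := (kh k).2 (by omega) (by omega)
      have e3 := ((kh' k).1 hk.1 hk.2).2
      have e4 := (kh' k).2 (by omega) (by omega)
      omega
    · exact hz k fun hk' => hk (by rw [mem_nodeIcc] at hk'; omega)
  have hA := sum_abs_eq_of_defect_eq hd'
  set p : Fin m := ⟨a, by omega⟩ with hp
  set q : Fin m := ⟨b + 1, hb⟩ with hq
  have hpq : p ≠ q := by simp only [hp, hq, Ne, Fin.ext_iff]; omega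
  have hcond : ∀ k, k ≠ p ∧ k ≠ q → (rowCrystal m n).wt h k = (rowCrystal m n).wt h' k :=
    fun k hk => hmid k (fun h => hk.1 (Fin.ext h)) (fun h => hk.2 (Fin.ext h))
  rw [Fintype.sum_eq_add p q hpq (fun k hk => by rw [hcond k hk, sub_self])] at hs hA
  have p1 := ((kh p).1 (by simp [hp]) (by simpa [hp] using hab)).2
  have p2 := ((kh' p).1 (by simp [hp]) (by simpa [hp] using hab)).2
  have q1 := (kh q).2 (by simp only [hq]; omega) (by simp [hq])
  have q2 := (kh' q).2 (by simp only [hq]; omega) (by simp [hq])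
  rw [abs_of_nonneg p1, abs_of_nonneg p2, abs_of_nonpos q1, abs_of_nonpos q2] at hA
  refine row_ext ?_ hd'
  ext k
  by_cases h1 : k = p
  · rw [h1]; omega
  · by_cases h2 : k = q
    · rw [h2]; omega
    · exact hcond k ⟨h1, h2⟩

theorem preservesComponents_Icc {a b : ℕ} (hb : b + 1 < m) (hab : a ≤ b) :
    PreservesComponents (nodeIcc m a b) (permEnd (rev a (b + 1) hb)) (rev a b (by omega)) := by
  intro n x y hw hd
  have hm : 2 ≤ m := by omega
  obtain ⟨h, h1, h2⟩ := exists_highest hm (nodeIcc m a b) x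
  obtain ⟨h', h1', h2'⟩ := exists_highest hm (nodeIcc m a b) y
  have hrev : ∀ k, (rev a (b + 1) hb).symm k = rev a (b + 1) hb k := fun _ => rfl
  have hcol : ∀ k, k ∉ nodeIcc m a b → ∀ j ∈ nodeIcc m a b, nodeCol j ≠ k := by
    intro k hk j hj hjk
    rw [show nodeCol j = j from if_pos (by rw [mem_nodeIcc] at hj; omega)] at hjk
    exact hk (hjk ▸ hj)
  have heq : h = h' := by
    refine highest_Icc_unique hb hab h2 h2' ?_ ?_ ?_
    · intro k hk
      rw [← sameComponent_defect hm h1 k (hcol k hk), ← sameComponent_defect hm h1' k (hcol k hk),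
        hd, show rev a b (by omega : b < m) k = k from
          Fin.ext (by rw [rev_val, if_neg (fun h => hk (mem_nodeIcc.2 h))])]
    · intro k hk
      have hroot : ∀ j ∈ nodeIcc m a b, simpleRoot j k = 0 := by
        intro j hj
        rw [mem_nodeIcc] at hj hk
        have e1 : ¬ k.1 = j.1 := by omega
        have e2 : j.1 + 1 < m := by omega
        have e3 : ¬ k.1 = j.1 + 1 := by omega
        simp [simpleRoot, Fin.ext_iff, e1, e2, e3]
      rw [← sameComponent_wt_apply hm h1 k hroot, ← sameComponent_wt_apply hm h1' k hroot, hw,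
        permEnd_apply, hrev, show rev a (b + 1) hb k = k from
          Fin.ext (by rw [rev_val, if_neg (fun h => hk (mem_nodeIcc.2 h))])]
    · have hroot : ∀ j ∈ nodeIcc m a b, simpleRoot j ⬝ᵥ (fun _ => (1 : ℤ)) = 0 := by
        intro j hj
        rw [mem_nodeIcc] at hj
        rw [simpleRoot_dotProduct hm]
        unfold nodeSnd
        rw [dif_pos (by omega), sub_self]
      have e1 := sameComponent_wt hm h1 _ hroot
      have e2 := sameComponent_wt hm h1' _ hroot
      simp only [dotProduct, mul_one] at e1 e2
      rw [Finset.sum_sub_distrib, ← e1, ← e2, hw, sub_eq_zero]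
      exact (Equiv.sum_comp (rev a (b + 1) hb).symm _).symm
  exact h1.trans _ _ _ (heq ▸ h1'.symm)

/-- Here a highest row has no defects from column a on, and its only weight coordinate there that
can be non-zero is z_a ≥ 0, which the length n determines. The coordinates before a are constant on
components and untouched by `negEnd a`. -/
theorem preservesComponents_spin {a : ℕ} (ha : a + 2 ≤ m) :
    PreservesComponents (nodeIcc m a m) (negEnd a) 1 := by
  intro n x y hw hd
  have hm : 2 ≤ m := by omega
  obtain ⟨h, h1, h2⟩ := exists_highest hm (nodeIcc m a m) x
  obtain ⟨h', h1', h2'⟩ := exists_highest hm (nodeIcc m a m) y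
  have key : ∀ g : RowTableau m n, (∀ j ∈ nodeIcc m a m, (rowCrystal m n).eps j g = 0) →
      ∀ k : Fin m, a ≤ k.1 → defect g k = 0 ∧ 0 ≤ (rowCrystal m n).wt g k ∧
        (a < k.1 → (rowCrystal m n).wt g k ≤ 0) := by
    intro g hg k hk
    have h3 := highest_node hm (hg k (mem_nodeIcc.2 ⟨hk, k.2.le⟩))
    refine ⟨?_, ?_, fun hk' => ?_⟩
    · by_cases hl : k.1 + 1 = m
      · exact defect_last g k hl
      · rw [show nodeCol k = k from if_pos (by omega)] at h3
        exact h3.1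
    · by_cases hl : k.1 + 1 = m
      · have := h3.2.2
        unfold nodeSnd at this
        rw [dif_neg (by omega)] at this
        omega
      · rw [show nodeCol k = k from if_pos (by omega)] at h3
        exact h3.2.1
    · have h4 := (highest_node hm (hg ⟨k.1 - 1, by omega⟩
        (mem_nodeIcc.2 ⟨by simp only; omega, by simp only; omega⟩))).2.2
      unfold nodeSnd at h4
      rw [dif_pos (by simp only; omega)] at h4
      rwa [show (⟨k.1 - 1 + 1, by omega⟩ : Fin m) = k from Fin.ext (by simp only; omega)] at h4
  have kh := key h h2
  have kh' := key h' h2'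
  have hout : ∀ k : Fin m, k.1 < a → defect h k = defect h' k ∧
      (rowCrystal m n).wt h k = (rowCrystal m n).wt h' k := by
    intro k hk
    have hcol : ∀ j ∈ nodeIcc m a m, nodeCol j ≠ k := by
      intro j hj hjk
      have := congrArg Fin.val hjk
      rw [mem_nodeIcc] at hj
      rw [nodeCol_val] at this
      split_ifs at this <;> omega
    have hroot : ∀ j ∈ nodeIcc m a m, simpleRoot j k = 0 := by
      intro j hj
      rw [mem_nodeIcc] at hj
      simp only [simpleRoot, Fin.ext_iff]
      split_ifs <;> omega
    constructor
    · rw [← sameComponent_defect hm h1 k hcol, ← sameComponent_defect hm h1' k hcol, hd,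
        Equiv.Perm.one_apply]
    · rw [← sameComponent_wt_apply hm h1 k hroot, ← sameComponent_wt_apply hm h1' k hroot, hw,
        negEnd_apply, if_pos hk]
  have hd' : ∀ k, defect h k = defect h' k := by
    intro k
    by_cases hk : k.1 < a
    · exact (hout k hk).1
    · rw [(kh k (by omega)).1, (kh' k (by omega)).1]
  set p : Fin m := ⟨a, by omega⟩ with hp
  have hne : ∀ k, k ≠ p → (rowCrystal m n).wt h k = (rowCrystal m n).wt h' k := by
    intro k hk
    have hk' : k.1 ≠ a := fun h => hk (Fin.ext h)
    by_cases hk : k.1 < a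
    · exact (hout k hk).2
    · have e1 := (kh k (by omega)).2
      have e2 := (kh' k (by omega)).2
      have e3 := e1.2 (by omega)
      have e4 := e2.2 (by omega)
      omega
  have hA := sum_abs_eq_of_defect_eq hd'
  rw [Fintype.sum_eq_single p (fun k hk => by rw [hne k hk, sub_self]),
    abs_of_nonneg (kh p (by simp [hp])).2.1, abs_of_nonneg (kh' p (by simp [hp])).2.1] at hA
  have heq : h = h' := by
    refine row_ext ?_ hd'
    ext k
    by_cases hk : k = p
    · rw [hk]; omega
    · exact hne k hk
  exact h1.trans _ _ _ (heq ▸ h1'.symm)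

theorem exists_spinFlip_row (b : RowTableau m n) : ∃ b' : RowTableau m n,
    (rowCrystal m n).wt b' = spinFlip ((rowCrystal m n).wt b) ∧ defect b' = defect b := by
  refine exists_row _ _ (defect_last b) ?_
  rw [← sum_abs_wt_add_defect b]
  congr 1
  refine Finset.sum_congr rfl fun k _ => ?_
  rw [spinFlip_apply]
  split_ifs <;> simp

/-- Flipping the sign of z_m and keeping the defects is a bijection of rows that exchanges the
operators of the two spin nodes, so it carries J-components to components for the swapped diagram.
-/
theorem preservesComponents_conj (hm : 2 ≤ m) {J : Finset (Fin m)}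
    {w : Module.End ℤ (Fin m → ℤ)} {π : Equiv.Perm (Fin m)} (h : PreservesComponents J w π) :
    PreservesComponents (J.image spinSwap) (spinFlip * w * spinFlip) π := by
  intro n c c' hw hd
  choose S hS hS' using exists_spinFlip_row (m := m) (n := n)
  have hSS : ∀ b, S (S b) = b := fun b =>
    row_ext (by rw [hS, hS, spinFlip_spinFlip]) (fun k => by rw [hS', hS'])
  have hmap : ∀ b b', (rowCrystal m n).SameComponent J b b' →
      (rowCrystal m n).SameComponent (J.image spinSwap) (S b) (S b') := by
    intro b b' hbb
    induction hbb with
    | rel b b' hb =>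
      obtain ⟨j, hj, hb⟩ := hb
      refine Relation.EqvGen.rel _ _ ⟨spinSwap j, Finset.mem_image_of_mem _ hj, ?_⟩
      have heps : ∀ b, (rowCrystal m n).eps (spinSwap j) (S b) = (rowCrystal m n).eps j b := by
        intro b
        rw [(rowCrystal_string hm _ _).1, (rowCrystal_string hm _ _).1, hS, hS',
          nodeCol_spinSwap hm, nodeSnd_spinSwap hm, spinFlip_spinFlip, spinFlip_nodeCol hm]
      obtain ⟨g1, g2, g3⟩ := row_f_imp hm hb
      refine (row_f_iff hm).2 ⟨?_, by rw [heps, heps, g2], fun k hk => ?_⟩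
      · rw [hS, hS, g1, map_sub, spinFlip_simpleRoot hm]
      · rw [nodeCol_spinSwap hm] at hk
        rw [hS', hS', g3 k hk]
    | refl => exact Relation.EqvGen.refl _
    | symm _ _ _ ih => exact ih.symm
    | trans _ _ _ _ _ ih ih' => exact ih.trans _ _ _ ih'
  have := hmap _ _ (h n (S c) (S c')
    (by rw [hS, hS, hw, Module.End.mul_apply, Module.End.mul_apply, spinFlip_spinFlip])
    (fun k => by rw [hS', hS', hd]))
  rwa [hSS, hSS] at this

theorem exists_cactusDatum (J : ConnectedSubdiagram m) (hm : 2 ≤ m) :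
    ∃ π, CactusDatum J.1 (longestElement J.1) π (theta J.1) ∧
      PreservesComponents J.1 (longestElement J.1) π := by
  have key : ∀ {J : Finset (Fin m)} {w π θ}, CactusDatum J w π θ →
      CactusDatum J (longestElement J) π (theta J) := by
    intro J w π θ h
    have hθ : ∀ j ∈ J, theta J j = θ j := fun j hj => h.theta_eq hm hj
    rw [h.longestElement_eq hm]
    refine ⟨h.w_mem, h.w_sq, ?_, h.π_sq, ?_, h.π_fix, h.π_mem, ?_⟩
    · intro j hj; rw [hθ j hj]; exact h.θ_mem j hj
    · intro j hj; rw [hθ j hj]; exact h.π_col j hj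
    · intro j hj; rw [hθ j hj]; exact h.w_node j hj
  obtain ⟨J, hJ⟩ := J
  rcases connected_classification hm hJ with ⟨a, b, hab, hb, rfl⟩ | ⟨a, ha, rfl⟩ | ⟨a, ha, rfl⟩
  · have h := cactusDatum_Icc (a := a) hb
    refine ⟨_, key h, ?_⟩
    rw [h.longestElement_eq hm]
    exact preservesComponents_Icc hb hab
  · have h := (cactusDatum_Icc (m := m) (a := a) (b := m - 2) (by omega)).conj hm
    refine ⟨_, key h, ?_⟩
    rw [h.longestElement_eq hm]
    exact preservesComponents_conj hm (preservesComponents_Icc (by omega) (by omega))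
  · have h := cactusDatum_spin (m := m) (a := a) (by omega)
    refine ⟨_, key h, ?_⟩
    rw [h.longestElement_eq hm]
    exact preservesComponents_spin (by omega)

end Components

/-! ### Schützenberger involutions -/

section Schutzenberger

variable {m n : ℕ} {J : Finset (Fin m)}

theorem isSchutzenberger_of_datum (hm : 2 ≤ m) {π : Equiv.Perm (Fin m)}
    (h : CactusDatum J (longestElement J) π (theta J))
    (hc : PreservesComponents J (longestElement J) π) (ξ : RowTableau m n → RowTableau m n)
    (hw : ∀ b, (rowCrystal m n).wt (ξ b) = longestElement J ((rowCrystal m n).wt b))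
    (hd : ∀ b k, defect (ξ b) k = defect b (π k)) : (rowCrystal m n).IsSchutzenberger J ξ := by
  have hπ : ∀ k, π (π k) = k := fun k => Equiv.congr_fun h.π_sq k
  have hww : ∀ z, longestElement J (longestElement J z) = z :=
    fun z => LinearMap.congr_fun h.w_sq z
  have hξ : ∀ b, ξ (ξ b) = b := fun b =>
    row_ext (by rw [hw, hw, hww]) (fun k => by rw [hd, hd, hπ])
  have hθ : ∀ j ∈ J, theta J (theta J j) = j := by
    intro j hj
    apply simpleRoot_injective
    rw [← neg_neg (simpleRoot (theta J (theta J j))),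
      ← h.w_simpleRoot hm (h.θ_mem j hj), ← map_neg, ← h.w_simpleRoot hm hj, hww]
  -- In the formulas for ε_j and φ_j, w either exchanges the two weight entries or negates both.
  -- Each alternative turns the formula for ε into that for φ.
  have hstr : ∀ j ∈ J, ∀ b, (rowCrystal m n).phi j (ξ b) = (rowCrystal m n).eps (theta J j) b ∧
      (rowCrystal m n).eps j (ξ b) = (rowCrystal m n).phi (theta J j) b := by
    intro j hj b
    rw [(rowCrystal_string hm _ _).1, (rowCrystal_string hm _ _).1, (rowCrystal_string hm _ _).2,
      (rowCrystal_string hm _ _).2, hw, hd, h.π_col j hj]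
    rcases h.w_node j hj ((rowCrystal m n).wt b) with ⟨h1, h2⟩ | ⟨h1, h2⟩ <;> rw [h1, h2] <;> omega
  -- One implication suffices: ξ and θ are involutions, so the others arise by substituting ξ b and
  -- θ j.
  have key : ∀ j ∈ J, ∀ b c, (rowCrystal m n).f j c = some (ξ b) →
      (rowCrystal m n).f (theta J j) b = some (ξ c) := by
    intro j hj b c hf
    have hphi := (rowCrystal_seminormal hm n).1.phi_f _ _ _ hf
    rw [row_f_iff hm] at hf ⊢
    obtain ⟨g1, g2, g3⟩ := hf
    refine ⟨?_, ?_, fun k hk => ?_⟩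
    · rw [hw] at g1 ⊢
      rw [← hww ((rowCrystal m n).wt b), g1, map_sub, h.w_simpleRoot hm hj]
      abel
    · rw [(hstr _ (h.θ_mem j hj) c).2, hθ j hj, hphi, (hstr j hj b).1]
    · rw [hd, ← g3 (π k) (fun hk' => hk (by rw [← h.π_col j hj, ← hk', hπ])), hd, hπ]
  refine ⟨fun b => hc n b (ξ b) (hw b) (hd b), hw, fun j hj b => ?_, fun j hj b => ?_⟩
  · ext c
    rw [row_e_iff hm, Option.map_eq_some_iff]
    constructor
    · intro hf
      exact ⟨ξ c, key j hj _ _ hf, hξ c⟩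
    · rintro ⟨b', hf, rfl⟩
      rw [← hξ b'] at hf
      have := key _ (h.θ_mem j hj) _ _ hf
      rwa [hθ j hj] at this
  · ext c
    rw [Option.map_eq_some_iff]
    constructor
    · intro hf
      rw [← hξ c] at hf
      exact ⟨ξ c, by rw [row_e_iff hm, key j hj _ _ hf, hξ], hξ c⟩
    · rintro ⟨b', hf, rfl⟩
      rw [row_e_iff hm, ← hξ b] at hf
      have := key _ (h.θ_mem j hj) _ _ hf
      rwa [hθ j hj] at this

theorem isSchutzenberger_eps (hm : 2 ≤ m) {ξ : RowTableau m n → RowTableau m n}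
    (h : (rowCrystal m n).IsSchutzenberger J ξ) {j : Fin m} (hj : j ∈ J) (k : ℕ) :
    ∀ b, (rowCrystal m n).phi (theta J j) b = k → (rowCrystal m n).eps j (ξ b) = k := by
  have hs := (rowCrystal_seminormal hm n).1
  induction k with
  | zero =>
    intro b hb
    rw [← hs.e_none, h.e_apply j hj, (hs.f_none _ _).2 hb]
    rfl
  | succ k ih =>
    intro b hb
    obtain ⟨b', hb'⟩ := Option.ne_none_iff_exists'.1
      (fun hn : (rowCrystal m n).f (theta J j) b = none => by rw [hs.f_none, hb] at hn; omega)
    have h1 := h.e_apply j hj b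
    rw [hb', Option.map_some, row_e_iff hm] at h1
    rw [hs.eps_f _ _ _ h1, ih b']
    have := hs.phi_f _ _ _ hb'
    omega

/-- The weight is prescribed. Given the weight, the defect in the column of a node j of J is read
off from ε_j(ξ b) = φ_{θ j}(b), and the other defects are constant on components. -/
theorem isSchutzenberger_unique (hm : 2 ≤ m) {ξ ξ' : RowTableau m n → RowTableau m n}
    (h : (rowCrystal m n).IsSchutzenberger J ξ) (h' : (rowCrystal m n).IsSchutzenberger J ξ') :
    ξ = ξ' := by
  funext b
  have hw : (rowCrystal m n).wt (ξ b) = (rowCrystal m n).wt (ξ' b) := by rw [h.weight, h'.weight]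
  refine row_ext hw fun k => ?_
  by_cases hk : ∃ j ∈ J, nodeCol j = k
  · obtain ⟨j, hj, rfl⟩ := hk
    rw [← eps_eq_iff_defect_eq hm j hw, isSchutzenberger_eps hm h hj _ b rfl,
      isSchutzenberger_eps hm h' hj _ b rfl]
  · push Not at hk
    rw [← sameComponent_defect hm (h.component b) k hk,
      ← sameComponent_defect hm (h'.component b) k hk]

end Schutzenberger

/-! ### The cactus group acts through weights and defects -/

section Relations

variable {m : ℕ} {J K : Finset (Fin m)} {π π' : Equiv.Perm (Fin m)}

theorem commute_of_mem_parabolic {x w : Module.End ℤ (Fin m → ℤ)}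
    (hx : ∀ j ∈ J, Commute x (simpleReflection j)) (hw : w ∈ parabolic J) : Commute x w := by
  obtain ⟨l, hl, rfl⟩ := hw
  induction l with
  | nil => simp [weylWord]
  | cons i l ih =>
    rw [weylWord_cons]
    exact (hx i (hl i (by simp))).mul_right (ih fun k hk => hl k (List.mem_cons_of_mem _ hk))

theorem not_adj_of_not_connected {J K : ConnectedSubdiagram m}
    (h : ¬ ((dynkin m).induce ((J.1 ∪ K.1 : Finset (Fin m)) : Set (Fin m))).Connected)
    {j k : Fin m} (hj : j ∈ J.1) (hk : k ∈ K.1) : j ≠ k ∧ ¬ (dynkin m).Adj j k := by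
  rw [Finset.coe_union] at h
  constructor
  · rintro rfl
    exact h (SimpleGraph.induce_union_connected J.2.preconnected K.2.preconnected ⟨j, hj, hk⟩)
  · intro hadj
    exact h (SimpleGraph.connected_induce_union J.2.preconnected K.2.preconnected hj hk hadj)

theorem longestElement_commute (hm : 2 ≤ m) (h : ∀ j ∈ J, ∀ k ∈ K, j ≠ k ∧ ¬ (dynkin m).Adj j k) :
    Commute (longestElement J) (longestElement K) := by
  refine commute_of_mem_parabolic (fun k hk => Commute.symm ?_) (longestElement_mem hm K)
  refine commute_of_mem_parabolic (fun j hj => ?_) (longestElement_mem hm J)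
  obtain ⟨h1, h2⟩ := h j hj k hk
  have h3 : simpleRoot j ⬝ᵥ simpleRoot k = 0 := by
    by_contra hne
    exact h2 ⟨h1, hne⟩
  refine mul_simpleReflection_of_dotProduct (simpleReflection_dotProduct hm k) (Or.inl ?_)
  rw [simpleReflection_apply, dotProduct_comm, h3, zero_smul, sub_zero]

/-- Distinct nodes with the same column are the two spin nodes, which have the same only neighbour.
Being adjacent to k, that neighbour is not in J, so J cannot extend beyond j. -/
theorem eq_singleton_of_spin_not_connected (hm : 3 ≤ m)
    (hJ : ((dynkin m).induce (J : Set (Fin m))).Connected) {j k : Fin m} (hj : j ∈ J)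
    (hjk : ∀ i ∈ J, i ≠ k ∧ ¬ (dynkin m).Adj i k) (hcol : nodeCol j = nodeCol k) :
    ∀ i ∈ J, i = j := by
  intro i hi
  have hne := (hjk j hj).1
  have hne' : j.1 ≠ k.1 := fun h => hne (Fin.ext h)
  have hc := congrArg Fin.val hcol
  rw [nodeCol_val, nodeCol_val] at hc
  have hj2 := j.2
  have hk2 := k.2
  have hcases : (j.1 + 1 = m ∧ k.1 + 2 = m) ∨ (j.1 + 2 = m ∧ k.1 + 1 = m) := by
    split_ifs at hc <;> omega
  refine connected_induction hJ (fun u => u = j) (fun u hu v hv huv hus => ?_) hj hi rfl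
  subst hus
  by_contra hvu
  have hvu' : v.1 ≠ u.1 := fun h => hvu (Fin.ext h)
  have hvk : v.1 ≠ k.1 := fun h => (hjk v hv).1 (Fin.ext h)
  have h2 := (hjk v hv).2
  have hv2 := v.2
  rw [dynkin_adj_iff_of_lt (by omega)] at h2
  have huv' := huv.symm
  rw [dynkin_adj_iff_of_lt (by omega)] at huv'
  omega

/-- Separated diagrams can share only the column of the spin nodes, and then J is a single node, so
π fixes that column. -/
theorem columnPerm_disjoint (hm : 3 ≤ m) (hJ : ((dynkin m).induce (J : Set (Fin m))).Connected)
    (h : ∀ j ∈ J, ∀ k ∈ K, j ≠ k ∧ ¬ (dynkin m).Adj j k)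
    (hπ : CactusDatum J (longestElement J) π (theta J))
    (hπ' : CactusDatum K (longestElement K) π' (theta K)) : π.Disjoint π' := by
  intro c
  by_cases h1 : ∃ j ∈ J, nodeCol j = c
  · by_cases h2 : ∃ k ∈ K, nodeCol k = c
    · obtain ⟨j, hj, rfl⟩ := h1
      obtain ⟨k, hk, hjk⟩ := h2
      have := eq_singleton_of_spin_not_connected hm hJ hj (fun i hi => h i hi k hk) hjk.symm
      left
      rw [hπ.π_col j hj, this _ (hπ.θ_mem j hj)]
    · push Not at h2
      exact Or.inr (hπ'.π_fix c h2)
  · push Not at h1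
    exact Or.inl (hπ.π_fix c h1)

namespace CactusDatum

theorem theta_theta (hm : 2 ≤ m) (h : CactusDatum J (longestElement J) π (theta J)) {j : Fin m}
    (hj : j ∈ J) : theta J (theta J j) = j := by
  apply simpleRoot_injective
  rw [← neg_neg (simpleRoot (theta J (theta J j))), ← h.w_simpleRoot hm (h.θ_mem j hj), ← map_neg,
    ← h.w_simpleRoot hm hj]
  exact LinearMap.congr_fun h.w_sq _

theorem mul_parabolic (hm : 2 ≤ m) (hK : CactusDatum K (longestElement K) π' (theta K))
    (hJK : J ⊆ K) {w : Module.End ℤ (Fin m → ℤ)} (hw : w ∈ parabolic J) :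
    longestElement K * w * longestElement K ∈ parabolic (J.image (theta K)) := by
  obtain ⟨l, hl, rfl⟩ := hw
  refine ⟨l.map (theta K), ?_, ?_⟩
  · intro i hi
    obtain ⟨j, hj, rfl⟩ := List.mem_map.1 hi
    exact Finset.mem_image_of_mem _ (hl j hj)
  · induction l with
    | nil => simp [weylWord, hK.w_sq]
    | cons i l ih =>
      have hi : i ∈ K := hJK (hl i (by simp))
      rw [List.map_cons, weylWord_cons, weylWord_cons,
        ih fun k hk => hl k (List.mem_cons_of_mem _ hk), ← mul_assoc, ← mul_assoc, ← mul_assoc,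
        ← mul_simpleReflection_of_dotProduct (parabolic_dotProduct hm hK.w_mem)
          (Or.inr (hK.w_simpleRoot hm hi))]

theorem conj_simpleRoot (hm : 2 ≤ m) (hJ : CactusDatum J (longestElement J) π (theta J))
    (hK : CactusDatum K (longestElement K) π' (theta K)) (hJK : J ⊆ K) {j : Fin m} (hj : j ∈ J) :
    (longestElement K * longestElement J * longestElement K) (simpleRoot (theta K j)) =
      -simpleRoot (theta K (theta J j)) := by
  rw [Module.End.mul_apply, Module.End.mul_apply, hK.w_simpleRoot hm (hK.θ_mem j (hJK hj)),
    hK.theta_theta hm (hJK hj), map_neg, hJ.w_simpleRoot hm hj, neg_neg,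
    hK.w_simpleRoot hm (hJK (hJ.θ_mem j hj))]

/-- Conjugation by w_{0,K} carries W_J to the parabolic subgroup of θ_K(J), and the conjugate of
w_{0,J} is again an involution sending simple roots to negatives of simple roots. -/
theorem longestElement_image (hm : 2 ≤ m) (hJ : CactusDatum J (longestElement J) π (theta J))
    (hK : CactusDatum K (longestElement K) π' (theta K)) (hJK : J ⊆ K) :
    longestElement (J.image (theta K)) =
      longestElement K * longestElement J * longestElement K := by
  apply _root_.longestElement_eq hm (hK.mul_parabolic hm hJK hJ.w_mem)
  · calc longestElement K * longestElement J * longestElement K *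
          (longestElement K * longestElement J * longestElement K)
        = longestElement K * longestElement J * (longestElement K * longestElement K) *
          longestElement J * longestElement K := by simp only [mul_assoc]
      _ = longestElement K * (longestElement J * longestElement J) * longestElement K := by
          rw [hK.w_sq]; simp only [mul_assoc, mul_one]
      _ = 1 := by rw [hJ.w_sq, mul_one, hK.w_sq]
  · intro i hi
    obtain ⟨j, hj, rfl⟩ := Finset.mem_image.1 hi
    exact ⟨_, Finset.mem_image_of_mem _ (hJ.θ_mem j hj), hJ.conj_simpleRoot hm hK hJK hj⟩

theorem columnPerm_image (hm : 2 ≤ m) {π'' : Equiv.Perm (Fin m)}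
    (hJ : CactusDatum J (longestElement J) π (theta J))
    (hK : CactusDatum K (longestElement K) π' (theta K)) (hJK : J ⊆ K)
    (hJ' : CactusDatum (J.image (theta K)) (longestElement (J.image (theta K))) π''
      (theta (J.image (theta K)))) : π * π' = π' * π'' := by
  ext1 c
  rw [Equiv.Perm.mul_apply, Equiv.Perm.mul_apply]
  have hπ' : ∀ k, π' (π' k) = k := fun k => Equiv.congr_fun hK.π_sq k
  by_cases hc : ∃ i ∈ J.image (theta K), nodeCol i = c
  · obtain ⟨i, hi, rfl⟩ := hc
    rw [hJ'.π_col i hi]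
    obtain ⟨j, hj, rfl⟩ := Finset.mem_image.1 hi
    have hθ : theta (J.image (theta K)) (theta K j) = theta K (theta J j) := by
      refine _root_.theta_eq hi (Finset.mem_image_of_mem _ (hJ.θ_mem j hj)) ?_
      rw [hJ.longestElement_image hm hK hJK]
      exact hJ.conj_simpleRoot hm hK hJK hj
    have hjK := hJK (hJ.θ_mem j hj)
    rw [hθ, hK.π_col _ (hK.θ_mem j (hJK hj)), hK.theta_theta hm (hJK hj), hJ.π_col j hj,
      hK.π_col _ (hK.θ_mem _ hjK), hK.theta_theta hm hjK]
  · push Not at hc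
    rw [hJ'.π_fix c hc]
    refine hJ.π_fix _ fun j hj hjc => hc _ (Finset.mem_image_of_mem _ hj) ?_
    rw [← hK.π_col j (hJK hj), hjc, hπ']

end CactusDatum

end Relations

/-! ### Symmetries of weights and defects, and the cactus action through them -/

section Action

variable {m : ℕ}

/-- Isometries for the `ℓ¹` norm together with permutations of the columns that fix the last
one. -/
def rowSymmetry (m : ℕ) : Subgroup ((Module.End ℤ (Fin m → ℤ))ˣ × Equiv.Perm (Fin m)) where
  carrier := {g | (∀ z, ∑ k, |g.1.1 z k| = ∑ k, |z k|) ∧ ∀ k : Fin m, k.1 + 1 = m → g.2 k = k}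
  one_mem' := ⟨fun _ => rfl, fun _ _ => rfl⟩
  mul_mem' := by
    rintro g g' ⟨h1, h2⟩ ⟨h1', h2'⟩
    refine ⟨fun z => (h1 _).trans (h1' z), fun k hk => ?_⟩
    rw [Prod.snd_mul, Equiv.Perm.mul_apply, h2' k hk, h2 k hk]
  inv_mem' := by
    rintro g ⟨h1, h2⟩
    refine ⟨fun z => ?_, fun k hk => ?_⟩
    · rw [← h1]
      have : g.1.1 ((g⁻¹).1.1 z) = z := LinearMap.congr_fun g.1.mul_inv z
      rw [this]
    · rw [Prod.snd_inv, Equiv.Perm.inv_eq_iff_eq, h2 k hk]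

theorem exists_rowSymmetry_smul {n : ℕ} (g : rowSymmetry m) (b : RowTableau m n) :
    ∃ b' : RowTableau m n, (rowCrystal m n).wt b' = g.1.1.1 ((rowCrystal m n).wt b) ∧
      defect b' = fun k => defect b (g.1.2⁻¹ k) := by
  refine exists_row _ _ (fun k hk => ?_) ?_
  · have := g⁻¹.2.2 k hk
    change g.1.2⁻¹ k = k at this
    rw [this, defect_last b k hk]
  · rw [g.2.1, ← sum_abs_wt_add_defect b, Equiv.sum_comp g.1.2⁻¹ fun k => (defect b k : ℤ)]

/-- The action of the symmetries on row tableaux, through weights and defects. -/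
noncomputable instance (n : ℕ) : SMul (rowSymmetry m) (RowTableau m n) where
  smul g b := (exists_rowSymmetry_smul g b).choose

theorem wt_smul {n : ℕ} (g : rowSymmetry m) (b : RowTableau m n) :
    (rowCrystal m n).wt (g • b) = g.1.1.1 ((rowCrystal m n).wt b) :=
  (exists_rowSymmetry_smul g b).choose_spec.1

theorem defect_smul {n : ℕ} (g : rowSymmetry m) (b : RowTableau m n) (k : Fin m) :
    defect (g • b) k = defect b (g.1.2⁻¹ k) :=
  congrFun (exists_rowSymmetry_smul g b).choose_spec.2 k

noncomputable instance (n : ℕ) : MulAction (rowSymmetry m) (RowTableau m n) where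
  one_smul b := row_ext (wt_smul 1 b) (defect_smul 1 b)
  mul_smul g g' b := by
    refine row_ext ?_ fun k => ?_
    · rw [wt_smul, wt_smul, wt_smul]; rfl
    · rw [defect_smul, defect_smul, defect_smul, Subgroup.coe_mul, Prod.snd_mul, mul_inv_rev,
        Equiv.Perm.mul_apply]

/-- The permutation of the columns attached to a connected subdiagram. -/
noncomputable def diagramPerm (hm : 2 ≤ m) (J : ConnectedSubdiagram m) : Equiv.Perm (Fin m) :=
  (exists_cactusDatum J hm).choose

theorem cactusDatum_diagramPerm (hm : 2 ≤ m) (J : ConnectedSubdiagram m) :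
    CactusDatum J.1 (longestElement J.1) (diagramPerm hm J) (theta J.1) :=
  (exists_cactusDatum J hm).choose_spec.1

/-- The symmetry by which the generator `c_J` acts. -/
noncomputable def diagramSymmetry (hm : 2 ≤ m) (J : ConnectedSubdiagram m) : rowSymmetry m :=
  ⟨(⟨longestElement J.1, longestElement J.1, (cactusDatum_diagramPerm hm J).w_sq,
    (cactusDatum_diagramPerm hm J).w_sq⟩, diagramPerm hm J),
    sum_abs_parabolic hm (longestElement_mem hm J.1),
    columnPerm_apply_last (cactusDatum_diagramPerm hm J).π_mem⟩

theorem rowSymmetry_ext {g g' : rowSymmetry m} (h1 : g.1.1.1 = g'.1.1.1) (h2 : g.1.2 = g'.1.2) :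
    g = g' := Subtype.ext (Prod.ext (Units.ext h1) h2)

theorem diagramSymmetry_relator (hm : 3 ≤ m) (r : FreeGroup (ConnectedSubdiagram m))
    (hr : CactusRelator m r) :
    FreeGroup.lift (diagramSymmetry (by omega : 2 ≤ m)) r = 1 := by
  have hm2 : 2 ≤ m := by omega
  have hd := cactusDatum_diagramPerm hm2
  cases hr with
  | sq J =>
    rw [map_mul, FreeGroup.lift_apply_of]
    exact rowSymmetry_ext (hd J).w_sq (hd J).π_sq
  | comm J K h =>
    have hna : ∀ j ∈ J.1, ∀ k ∈ K.1, j ≠ k ∧ ¬ (dynkin m).Adj j k :=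
      fun j hj k hk => not_adj_of_not_connected h hj hk
    rw [map_mul, map_inv, map_mul, map_mul, FreeGroup.lift_apply_of, FreeGroup.lift_apply_of,
      mul_inv_eq_one]
    exact rowSymmetry_ext (longestElement_commute hm2 hna)
      (columnPerm_disjoint hm J.2 hna (hd J) (hd K)).commute
  | nest J K J' h h' =>
    rw [map_mul, map_inv, map_mul, map_mul, FreeGroup.lift_apply_of, FreeGroup.lift_apply_of,
      FreeGroup.lift_apply_of, mul_inv_eq_one]
    have hJ' := hd J'
    rw [h'] at hJ'
    refine rowSymmetry_ext ?_ ((hd J).columnPerm_image hm2 (hd K) h hJ')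
    change longestElement J.1 * longestElement K.1 = longestElement K.1 * longestElement J'.1
    rw [h', (hd J).longestElement_image hm2 (hd K) h, ← mul_assoc, ← mul_assoc, (hd K).w_sq,
      one_mul]

/-- The homomorphism from the cactus group to the symmetries of row tableaux. -/
noncomputable def cactusHom (hm : 3 ≤ m) : CactusGroup m →* rowSymmetry m :=
  PresentedGroup.toGroup (diagramSymmetry_relator hm)

theorem cactusHom_gen (hm : 3 ≤ m) (J : ConnectedSubdiagram m) :
    cactusHom hm (cactusGen J) = diagramSymmetry (by omega) J :=
  PresentedGroup.toGroup.of _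

theorem isCactusAction_cactusHom (hm : 3 ≤ m) (n : ℕ) :
    IsCactusAction m n
      ((MulAction.toPermHom (rowSymmetry m) (RowTableau m n)).comp (cactusHom hm)) := by
  intro J
  have hm2 : 2 ≤ m := by omega
  have hd := cactusDatum_diagramPerm hm2 J
  have hinv : (diagramPerm hm2 J)⁻¹ = diagramPerm hm2 J := inv_eq_of_mul_eq_one_left hd.π_sq
  refine isSchutzenberger_of_datum hm2 hd (exists_cactusDatum J hm2).choose_spec.2 _
    (fun b => ?_) fun b k => ?_
  · rw [MonoidHom.comp_apply, cactusHom_gen]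
    exact wt_smul _ b
  · rw [MonoidHom.comp_apply, cactusHom_gen]
    refine (defect_smul _ b k).trans ?_
    exact congrArg (fun π : Equiv.Perm (Fin m) => defect b (π k)) hinv

theorem isCactusAction_unique (hm : 2 ≤ m) {n : ℕ}
    {ρ ρ' : CactusGroup m →* Equiv.Perm (RowTableau m n)} (h : IsCactusAction m n ρ)
    (h' : IsCactusAction m n ρ') : ρ = ρ' :=
  PresentedGroup.ext fun J => DFunLike.coe_injective (isSchutzenberger_unique hm (h J) (h' J))

end Action

/-! ### Generation by subdiagrams of size one and two -/

section Generation

variable {m : ℕ}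

/-- The group generated by the symmetries attached to connected subdiagrams of size `1`
and `2`. -/
noncomputable def smallGroup (hm : 2 ≤ m) : Subgroup (rowSymmetry m) :=
  Subgroup.closure (diagramSymmetry hm '' {J | J.1.card = 1 ∨ J.1.card = 2})

/-- The diagram with the single node `i`. -/
def singletonDiagram (i : Fin m) : ConnectedSubdiagram m :=
  ⟨{i}, by
    rw [Finset.coe_singleton]
    exact { preconnected := fun u v => by rw [Subsingleton.elim u v], nonempty := ⟨⟨i, rfl⟩⟩ }⟩

/-- For a single node i, θ fixes i, hence π fixes its column and every other one; the generator acts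
by (s_i, 1). -/
theorem reflection_mem_smallGroup (hm : 2 ≤ m) (g : rowSymmetry m) (i : Fin m)
    (h1 : g.1.1.1 = simpleReflection i) (h2 : g.1.2 = 1) : g ∈ smallGroup hm := by
  have hg : g = diagramSymmetry hm (singletonDiagram i) := by
    have hd := cactusDatum_diagramPerm hm (singletonDiagram i)
    have hi : i ∈ (singletonDiagram i).1 := Finset.mem_singleton_self i
    refine rowSymmetry_ext ?_ ?_
    · rw [h1]
      refine (longestElement_eq hm (simpleReflection_mem_parabolic hi)
        (simpleReflection_mul_self hm i) fun j hj => ⟨i, hi, ?_⟩).symm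
      rw [Finset.mem_singleton.1 hj, simpleReflection_simpleRoot hm]
    · rw [h2]
      change 1 = diagramPerm hm _
      ext1 k
      rw [Equiv.Perm.one_apply]
      by_cases hk : nodeCol i = k
      · rw [← hk, hd.π_col i hi, Finset.mem_singleton.1 (hd.θ_mem i hi)]
      · rw [hd.π_fix k fun j hj => by rwa [Finset.mem_singleton.1 hj]]
  rw [hg]
  exact Subgroup.subset_closure ⟨_, Or.inl (Finset.card_singleton i), rfl⟩

theorem parabolic_mem_smallGroup (hm : 2 ≤ m) (l : List (Fin m)) :
    ∀ g : rowSymmetry m, g.1.1.1 = weylWord l → g.1.2 = 1 → g ∈ smallGroup hm := by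
  induction l with
  | nil =>
    intro g h1 h2
    rw [show g = 1 from rowSymmetry_ext (by rw [h1]; rfl) h2]
    exact one_mem _
  | cons i l ih =>
    intro g h1 h2
    let s : rowSymmetry m := ⟨(⟨simpleReflection i, simpleReflection i,
      simpleReflection_mul_self hm i, simpleReflection_mul_self hm i⟩, 1),
      sum_abs_parabolic hm (simpleReflection_mem_parabolic (Finset.mem_singleton_self i)),
      fun _ _ => rfl⟩
    have hs : s ∈ smallGroup hm := reflection_mem_smallGroup hm s i rfl rfl
    rw [← mul_inv_cancel_left s⁻¹ g, inv_inv]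
    refine mul_mem (inv_mem hs) (ih _ ?_ ?_)
    · change simpleReflection i * g.1.1.1 = _
      rw [h1, weylWord_cons, ← mul_assoc, simpleReflection_mul_self hm, one_mul]
    · change 1 * g.1.2 = 1
      rw [h2, one_mul]

/-- The diagram with the nodes `k` and `k + 1`. -/
def pairDiagram (k : ℕ) (hk : k + 2 < m) : ConnectedSubdiagram m :=
  ⟨{⟨k, by omega⟩, ⟨k + 1, by omega⟩}, by
    rw [Finset.coe_pair]
    refine SimpleGraph.induce_pair_connected_of_adj ?_
    rw [dynkin_adj_iff_of_lt (by simp)]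
    left
    exact ⟨rfl, hk⟩⟩

/-- The chosen permutation is forced: θ dictates it on the columns of J, and it is the identity
elsewhere. -/
theorem diagramPerm_pair (hm : 2 ≤ m) (k : ℕ) (hk : k + 2 < m) :
    diagramPerm hm (pairDiagram k hk) =
      Equiv.swap (⟨k, by omega⟩ : Fin m) ⟨k + 1, by omega⟩ := by
  have hset : (pairDiagram k hk).1 = nodeIcc m k (k + 1) := by
    ext i
    rw [mem_nodeIcc]
    simp only [pairDiagram, Finset.mem_insert, Finset.mem_singleton, Fin.ext_iff]
    omega
  have hd := cactusDatum_diagramPerm hm (pairDiagram k hk)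
  have hI := cactusDatum_Icc (m := m) (a := k) (b := k + 1) (by omega)
  rw [hset] at hd
  have hrev : ∀ c, diagramPerm hm (pairDiagram k hk) c = rev k (k + 1) (by omega) c := by
    intro c
    by_cases hc : ∃ j ∈ nodeIcc m k (k + 1), nodeCol j = c
    · obtain ⟨j, hj, rfl⟩ := hc
      rw [hd.π_col j hj, hI.π_col j hj, hI.theta_eq hm hj]
    · push Not at hc
      rw [hd.π_fix c hc, hI.π_fix c hc]
  ext c
  rw [hrev, rev_val, swap_val]
  simp only
  split_ifs <;> omega

theorem columnPerm_mem_smallGroup (hm : 2 ≤ m) {π : Equiv.Perm (Fin m)} (hπ : π ∈ columnPerm m) :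
    ∃ g ∈ smallGroup hm, g.1 = (1, π) := by
  have hle : columnPerm m ≤ ((smallGroup hm).map (rowSymmetry m).subtype).comap
      (MonoidHom.inr (Module.End ℤ (Fin m → ℤ))ˣ (Equiv.Perm (Fin m))) := by
    rw [columnPerm, Subgroup.closure_le]
    rintro _ ⟨k, hk, rfl⟩
    have hw := longestElement_mem hm (pairDiagram k hk).1
    obtain ⟨l, -, hl⟩ := hw
    have hd := cactusDatum_diagramPerm hm (pairDiagram k hk)
    let u : rowSymmetry m := ⟨(⟨longestElement (pairDiagram k hk).1,
      longestElement (pairDiagram k hk).1, hd.w_sq, hd.w_sq⟩, 1),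
      sum_abs_parabolic hm (longestElement_mem hm _), fun _ _ => rfl⟩
    have hu : u ∈ smallGroup hm := parabolic_mem_smallGroup hm l u hl.symm rfl
    have hJ : diagramSymmetry hm (pairDiagram k hk) ∈ smallGroup hm :=
      Subgroup.subset_closure ⟨_, Or.inr (Finset.card_pair (by simp [Fin.ext_iff])), rfl⟩
    -- The Weyl component of the pair generator is an involution that is available on its own;
    -- multiplying by it leaves the bare transposition of columns.
    refine ⟨u * diagramSymmetry hm (pairDiagram k hk), mul_mem hu hJ, ?_⟩
    refine Prod.ext (Units.ext hd.w_sq) ?_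
    exact (one_mul _).trans (diagramPerm_pair hm k hk)
  obtain ⟨g, hg, h⟩ := hle hπ
  exact ⟨g, hg, h⟩

/-- Both components of (w_{0,J}, π_J) can be generated separately: the first by the reflections, the
second by adjacent transpositions. -/
theorem diagramSymmetry_mem_smallGroup (hm : 2 ≤ m) (J : ConnectedSubdiagram m) :
    diagramSymmetry hm J ∈ smallGroup hm := by
  have hd := cactusDatum_diagramPerm hm J
  obtain ⟨g, hg, hg'⟩ := columnPerm_mem_smallGroup hm hd.π_mem
  obtain ⟨l, -, hl⟩ := longestElement_mem hm J.1
  rw [← mul_inv_cancel_right (diagramSymmetry hm J) g⁻¹, inv_inv]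
  refine mul_mem (parabolic_mem_smallGroup hm l _ ?_ ?_) hg
  · rw [Subgroup.coe_mul, Subgroup.coe_inv, hg', hl]
    simp [diagramSymmetry]
  · rw [Subgroup.coe_mul, Subgroup.coe_inv, hg']
    simp [diagramSymmetry]

/-- An arbitrary ψ allows the same statement to serve for the action on rows of one length and for
the product over all lengths. -/
theorem range_comp_cactusHom (hm : 3 ≤ m) {G : Type*} [Group G] (ψ : rowSymmetry m →* G) :
    (ψ.comp (cactusHom hm)).range = Subgroup.closure
      {g | ∃ J : ConnectedSubdiagram m,
        (J.1.card = 1 ∨ J.1.card = 2) ∧ ψ.comp (cactusHom hm) (cactusGen J) = g} := by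
  apply le_antisymm
  · have hm2 : 2 ≤ m := by omega
    have h1 : (smallGroup hm2).map ψ ≤ Subgroup.closure
        {g | ∃ J : ConnectedSubdiagram m,
          (J.1.card = 1 ∨ J.1.card = 2) ∧ ψ.comp (cactusHom hm) (cactusGen J) = g} := by
      rw [smallGroup, MonoidHom.map_closure, Subgroup.closure_le]
      rintro _ ⟨_, ⟨J, hJ, rfl⟩, rfl⟩
      refine Subgroup.subset_closure ⟨J, hJ, ?_⟩
      rw [MonoidHom.comp_apply, cactusHom_gen]
    refine le_trans ?_ h1
    rw [MonoidHom.range_eq_map, ← PresentedGroup.closure_range_of, MonoidHom.map_closure,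
      Subgroup.closure_le]
    rintro _ ⟨_, ⟨J, rfl⟩, rfl⟩
    exact ⟨_, diagramSymmetry_mem_smallGroup hm2 J, congrArg ψ (cactusHom_gen hm J).symm⟩
  · rw [Subgroup.closure_le]
    rintro _ ⟨J, -, rfl⟩
    exact ⟨_, rfl⟩

end Generation

theorem mainTheorem4 (m : ℕ) (hm : 3 ≤ m) :
    (∀ n : ℕ, ∃! ρ : CactusGroup m →* Equiv.Perm (RowTableau m n), IsCactusAction m n ρ) ∧
    ∀ ρ : (n : ℕ) → (CactusGroup m →* Equiv.Perm (RowTableau m n)),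
      (∀ n, IsCactusAction m n (ρ n)) →
      (∀ n, (ρ n).range = Subgroup.closure
        {g | ∃ J : ConnectedSubdiagram m,
          (J.1.card = 1 ∨ J.1.card = 2) ∧ ρ n (cactusGen J) = g}) ∧
      (MonoidHom.pi ρ).range = Subgroup.closure
        {g | ∃ J : ConnectedSubdiagram m,
          (J.1.card = 1 ∨ J.1.card = 2) ∧ MonoidHom.pi ρ (cactusGen J) = g} := by
  refine ⟨fun n => ⟨_, isCactusAction_cactusHom hm n, fun ρ hρ =>
    isCactusAction_unique (by omega) hρ (isCactusAction_cactusHom hm n)⟩, fun ρ hρ => ?_⟩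
  -- By uniqueness any family of cactus actions is the one that factors through `cactusHom`, with
  -- the same homomorphism for all n.
  obtain rfl : ρ = fun n =>
      (MulAction.toPermHom (rowSymmetry m) (RowTableau m n)).comp (cactusHom hm) :=
    funext fun n => isCactusAction_unique (by omega) (hρ n) (isCactusAction_cactusHom hm n)
  exact ⟨fun n => range_comp_cactusHom hm _, range_comp_cactusHom hm
    (MonoidHom.pi fun n => MulAction.toPermHom (rowSymmetry m) (RowTableau m n))⟩
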